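/- Let $\gamma>0$ and let $u\in C^0((-\infty,0])$ be real-valued and such that $t\mapsto e^{\gamma t}u(t)$ is bounded on $(-\infty,0]$. Consider, without initial condition, the problem $$\partial_t w(t,\lambda)=\partial_\lambda^2 w(t,\lambda)-\gamma w(t,\lambda)\quad (t\le 0,\ 0\le\lambda<1),\qquad \partial_\lambda w(t,0)=0,\quad w(t,1)=u(t)\quad (t\le 0).$$ A classical solution is a function $w$, continuous on $(-\infty,0]\times[0,1]$, that satisfies these equations and belongs to $C^1((-\infty,0],C^2([0,1)))$, i.e. to $C^1((-\infty,0],C^2([0,r]))$ for every $0<r<1$ (derivatives at end points being one-sided; $C^m(I,\mathcal B)$ denotes the $m$ times continuously Fréchet differentiable functions from $I$ to the Banach space $\mathcal B$). Then there is exactly one classical solution $w_u$ for which there exists $C>0$ such that $\|w_u(t,\cdot)\|_{L^2(0,1)}<Ce^{-\gamma t}$ for all $t\le 0$. Moreover, for every $t\le 0$, $w_u(t,\cdot)\in\mathcal A$, where $\mathcal A$ is the space of functions $v\in L^2(0,1)$ that are analytic on $[0,1)$ and satisfy $\frac{d^{2k+1}v}{d\lambda^{2k+1}}(0)=0$ for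 all $k\in\mathbb N$. Finally, the regularity of $w_u$ extends up to $\lambda=1$, in the sense that $w_u\in C^1((-\infty,0],C^2([0,1]))$, if and only if $u\in C^2((-\infty,0])$. -/

import Mathlib

open Set MeasureTheory

namespace SteadyHeat

/-- `w ∈ C¹((-∞, 0], C²([0, r]))` (Fréchet differentiability in the Banach space `C²([0, r])`).
Since `v ↦ (v, v', v'')` embeds `C²([0, r])`, with its usual norm, as a closed subspace of
`C([0, r])³`, this says that `t ↦ ∂ₓʲ w(t, ·)`, for `j = 0, 1, 2`, are `C¹` maps
from `(-∞, 0]` to `C([0, r])` with the sup norm. Derivatives at end points are one-sided. -/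
def MemC1C2 (w : ℝ → ℝ → ℝ) (r : ℝ) : Prop :=
  (∀ t ≤ 0, ContDiffOn ℝ 2 (w t) (Icc 0 r)) ∧
  ∀ j : ℕ, j ≤ 2 → ∃ W : ℝ → C(Icc (0 : ℝ) r, ℝ),
    ContDiffOn ℝ 1 W (Iic 0) ∧
    ∀ t ≤ 0, ∀ x : Icc (0 : ℝ) r, W t x = iteratedDerivWithin j (w t) (Icc 0 r) x

/-- Classical solutions `w`, on `(-∞, 0] × [0, 1]`, of
`∂ₜ w = ∂ₓ² w - γ w`, `∂ₓ w(t, 0) = 0`, `w(t, 1) = u(t)`: continuous up to the boundary `x = 1`,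
and `C¹` in time with values in `C²([0, 1))`, that is in `C²([0, r])` for every `r < 1`. -/
structure IsClassicalSolution (γ : ℝ) (u : ℝ → ℝ) (w : ℝ → ℝ → ℝ) : Prop where
  continuousOn : ContinuousOn (fun p : ℝ × ℝ => w p.1 p.2) (Iic 0 ×ˢ Icc 0 1)
  memC1C2 : ∀ r : ℝ, 0 < r → r < 1 → MemC1C2 w r
  heat : ∀ t ≤ 0, ∀ x ∈ Ico (0 : ℝ) 1,
    derivWithin (fun s => w s x) (Iic 0) t
      = iteratedDerivWithin 2 (w t) (Ico 0 1) x - γ * w t x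
  neumann : ∀ t ≤ 0, derivWithin (w t) (Ico 0 1) 0 = 0
  dirichlet : ∀ t ≤ 0, w t 1 = u t

/-- There is `C > 0` with `‖w(t, ·)‖_{L²(0,1)} < C e^{-γ t}` for all `t ≤ 0`. -/
def HasL2Bound (γ : ℝ) (w : ℝ → ℝ → ℝ) : Prop :=
  ∃ C : ℝ, 0 < C ∧ ∀ t ≤ 0,
    eLpNorm (w t) 2 (volume.restrict (Ioo 0 1)) < ENNReal.ofReal (C * Real.exp (-γ * t))

/-- The space `𝒜` of functions in `L²(0,1)`, analytic on `[0, 1)`, all of whose derivatives of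
odd order vanish at `0`. -/
def spaceA : Set (ℝ → ℝ) :=
  {v | MemLp v 2 (volume.restrict (Ioo 0 1)) ∧ AnalyticOn ℝ v (Ico 0 1) ∧
    ∀ k : ℕ, iteratedDerivWithin (2 * k + 1) v (Ico 0 1) 0 = 0}

end SteadyHeat

/-! The factor `exp (γ t)` removes the damping: `v = exp (γ t) w` solves the heat equation with
bounded boundary values `g = exp (γ t) u` at `x = 1`.

Existence. On a half-line, the bounded solution with boundary values `φ` at distance `y` from the
end is an average of the past of `φ`, namely of `φ (t - y² s)` against a probability density in `s`
(`halfLine`). The sum of two such solutions, at distances `1 - x` and `1 + x`, is even in `x`, so it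
satisfies the Neumann condition. Its value at `x = 1` is `φ + Kφ`, where `K = transfer` averages and
fixes constants. Since `K` need not have norm less than `1`, the series for `(1 + K)⁻¹` is
unavailable. Instead `1 + K = 2 (1 - A)` with `A = (1 - K) / 2`. In `A² = (1 - 2K + K²) / 4` the
terms `-2K` and `K²` partly cancel, because `K` and `K²` dominate a common moving average. Hence
`‖A²‖ < 1` and `1 + K` is onto (`exists_add_transfer_eq`). Away from the boundary the kernels are
smooth in `(t, y)` and extend holomorphically in `y`, which gives interior smoothness and
analyticity; evenness kills the odd derivatives at `0`.

Uniqueness. If `cos μ = 0`, the coefficient of a solution against `cos (μ x)`, times `exp ((γ + μ²)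
t)`, has a derivative that depends on `u` only (`coeff_sub`). For a difference of two solutions this
product is constant in `t`, and the `L²` bounds make it `O (exp (μ² t))` as `t → -∞`, so it is zero.
These cosines are complete (`eq_zero_of_integral_cos_eq_zero`).

Regularity at `x = 1`. If `w` is `C¹` with values in `C²([0, 1])`, the equation makes `∂ₜ w` a `C¹`
curve in `C([0, 1])`, and evaluation at `1` gives `u ∈ C²`. Conversely, `u ∈ C²` gives `φ ∈ C²`
because `Kφ` is smooth; then `v` is a `C²` curve in `C([0, 1])` (`contDiffOn_restr_sol`), and `∂ₓ² v
= ∂ₜ v` recovers the space derivatives up to the boundary by integration. -/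

namespace SteadyHeat

open Filter Topology

/-! ### The kernels `τ ^ (-m / 2) * exp (-y ^ 2 / (4 τ))` -/

/-- The kernel `τ ^ (-m / 2) * exp (-y ^ 2 / (4 τ))`, which vanishes for `τ ≤ 0` when `m ≠ 0`. -/
noncomputable def kap (m : ℕ) (τ y : ℝ) : ℝ :=
  (√τ)⁻¹ ^ m * Real.exp (-(y * (√τ)⁻¹) ^ 2 / 4)

theorem kap_nonneg (m : ℕ) (τ y : ℝ) : 0 ≤ kap m τ y := by unfold kap; positivity

theorem kap_of_nonpos {m : ℕ} (hm : m ≠ 0) {τ : ℝ} (hτ : τ ≤ 0) (y : ℝ) : kap m τ y = 0 := by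
  simp [kap, Real.sqrt_eq_zero_of_nonpos hτ, hm]

theorem kap_pos {m : ℕ} {τ : ℝ} (hτ : 0 < τ) (y : ℝ) : 0 < kap m τ y := by
  have := Real.sqrt_pos.2 hτ
  unfold kap; positivity

@[fun_prop]
theorem measurable_kap (m : ℕ) : Measurable fun p : ℝ × ℝ => kap m p.1 p.2 := by
  unfold kap; fun_prop

theorem exists_pow_mul_exp_le (m : ℕ) {δ : ℝ} (hδ : 0 < δ) :
    ∃ C, 0 < C ∧ ∀ ρ y : ℝ, 0 ≤ ρ → δ ≤ |y| → ρ ^ m * Real.exp (-(y * ρ) ^ 2 / 4) ≤ C := by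
  -- The summand `1` serves for `ρ ≤ 1`; the other comes from `X ^ m / m! ≤ exp X` at `X = δ² ρ² /
  -- 4`, together with `ρ ^ m ≤ (ρ²) ^ m` for `ρ ≥ 1`.
  refine ⟨1 + (4 / δ ^ 2) ^ m * m.factorial, by positivity, fun ρ y hρ hy => ?_⟩
  rw [neg_div, Real.exp_neg, ← div_eq_mul_inv, div_le_iff₀ (Real.exp_pos _)]
  have hx : δ ^ 2 * ρ ^ 2 / 4 ≤ (y * ρ) ^ 2 / 4 := by
    rw [mul_pow, ← sq_abs y]; gcongr
  rcases le_total ρ 1 with h | h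
  · have h1 : ρ ^ m ≤ 1 := pow_le_one₀ hρ h
    have h2 : 1 ≤ Real.exp ((y * ρ) ^ 2 / 4) := Real.one_le_exp (by positivity)
    have h3 : (0 : ℝ) ≤ (4 / δ ^ 2) ^ m * m.factorial := by positivity
    nlinarith
  · have h1 : ρ ^ m ≤ (ρ ^ 2) ^ m := pow_le_pow_left₀ hρ (by nlinarith) m
    have h2 := Real.pow_div_factorial_le_exp (δ ^ 2 * ρ ^ 2 / 4) (by positivity) m
    have h3 := h2.trans (Real.exp_le_exp.2 hx)
    rw [div_le_iff₀ (by positivity)] at h3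
    have h4 : (ρ ^ 2) ^ m = (4 / δ ^ 2) ^ m * (δ ^ 2 * ρ ^ 2 / 4) ^ m := by
      rw [← mul_pow]; congr 1; field_simp
    have h5 : (0 : ℝ) ≤ (4 / δ ^ 2) ^ m := by positivity
    have h6 := mul_le_mul_of_nonneg_left h3 h5
    have h7 := Real.exp_pos ((y * ρ) ^ 2 / 4)
    nlinarith

theorem kap_le_pow (m : ℕ) (τ y : ℝ) : kap m τ y ≤ (√τ)⁻¹ ^ m := by
  unfold kap
  refine mul_le_of_le_one_right (by positivity) (Real.exp_le_one_iff.2 ?_)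
  have := sq_nonneg (y * (√τ)⁻¹)
  linarith

theorem kap_add (m n : ℕ) (τ y : ℝ) : kap (m + n) τ y = (√τ)⁻¹ ^ m * kap n τ y := by
  unfold kap; ring

theorem exists_kap_le (m : ℕ) {δ : ℝ} (hδ : 0 < δ) :
    ∃ C, 0 < C ∧ ∀ τ y : ℝ, δ ≤ |y| ∨ δ ≤ τ → kap m τ y ≤ C := by
  obtain ⟨C, hC, h⟩ := exists_pow_mul_exp_le m hδ
  refine ⟨C + (√δ)⁻¹ ^ m, by positivity, fun τ y hy => ?_⟩
  have h0 : 0 ≤ (√δ)⁻¹ ^ m := by positivity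
  rcases hy with hy | hy
  · exact (h (√τ)⁻¹ y (by positivity) hy).trans (by linarith)
  · refine (kap_le_pow m τ y).trans ?_
    have : (√τ)⁻¹ ≤ (√δ)⁻¹ := inv_anti₀ (Real.sqrt_pos.2 hδ) (Real.sqrt_le_sqrt hy)
    have := pow_le_pow_left₀ (by positivity) this m
    linarith

/-- For large `τ` the factor `τ ^ (-3 / 2)` split off from the kernel gives integrable decay; this
is the reason for `3 ≤ m`. For small `τ` boundedness suffices. -/
theorem exists_kap_le_rpow {m : ℕ} (hm : 3 ≤ m) {δ : ℝ} (hδ : 0 < δ) :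
    ∃ C, 0 < C ∧ ∀ τ y : ℝ, δ ≤ |y| ∨ δ ≤ τ →
      kap m τ y ≤ C * (1 + |τ|) ^ (-(3 / 2) : ℝ) := by
  obtain ⟨C₁, hC₁, h₁⟩ := exists_kap_le m hδ
  obtain ⟨C₂, hC₂, h₂⟩ := exists_kap_le (m - 3) hδ
  refine ⟨(C₁ + C₂) * 2 ^ (3 / 2 : ℝ), by positivity, fun τ y hy => ?_⟩
  rcases le_or_gt τ 0 with h0 | h0
  · rw [kap_of_nonpos (by omega) h0]; positivity
  rw [Real.rpow_neg (by positivity), ← div_eq_mul_inv, le_div_iff₀ (by positivity), abs_of_pos h0]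
  have hk := kap_nonneg m τ y
  rcases le_total τ 1 with h1 | h1
  · have e1 : (1 + τ) ^ (3 / 2 : ℝ) ≤ 2 ^ (3 / 2 : ℝ) :=
      Real.rpow_le_rpow (by positivity) (by linarith) (by norm_num)
    have e2 := h₁ τ y hy
    exact mul_le_mul (by linarith) e1 (by positivity) (by positivity)
  · have e1 : (1 + τ) ^ (3 / 2 : ℝ) ≤ 2 ^ (3 / 2 : ℝ) * τ ^ (3 / 2 : ℝ) := by
      rw [← Real.mul_rpow (by norm_num) h0.le]
      exact Real.rpow_le_rpow (by positivity) (by linarith) (by norm_num)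
    have e3 : τ ^ (3 / 2 : ℝ) = √τ ^ 3 := by
      rw [Real.sqrt_eq_rpow, ← Real.rpow_natCast, ← Real.rpow_mul h0.le]; norm_num
    have e4 : kap m τ y * √τ ^ 3 = kap (m - 3) τ y := by
      have := Real.sqrt_pos.2 h0
      conv_lhs => rw [← Nat.add_sub_cancel' hm, kap_add]
      field_simp
    have e2 := h₂ τ y hy
    calc kap m τ y * (1 + τ) ^ (3 / 2 : ℝ)
        ≤ kap m τ y * (2 ^ (3 / 2 : ℝ) * τ ^ (3 / 2 : ℝ)) := by gcongr
      _ = kap (m - 3) τ y * 2 ^ (3 / 2 : ℝ) := by rw [e3, ← e4]; ring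
      _ ≤ _ := by gcongr; linarith

/-- The derivative of `kap m` at `(τ, y)`. -/
noncomputable def kapDeriv (m : ℕ) (τ y : ℝ) : ℝ × ℝ →L[ℝ] ℝ :=
  (-(m / 2) * kap (m + 2) τ y + y ^ 2 / 4 * kap (m + 4) τ y) • ContinuousLinearMap.fst ℝ ℝ ℝ +
    (-(y / 2) * kap (m + 2) τ y) • ContinuousLinearMap.snd ℝ ℝ ℝ

theorem hasFDerivAt_kap_of_pos (m : ℕ) {p : ℝ × ℝ} (hp : 0 < p.1) :
    HasFDerivAt (fun q : ℝ × ℝ => kap m q.1 q.2) (kapDeriv m p.1 p.2) p := by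
  have hs : 0 < √p.1 := Real.sqrt_pos.2 hp
  have h1 : HasFDerivAt (fun q : ℝ × ℝ => (√q.1)⁻¹)
      ((-(√p.1)⁻¹ ^ 3 / 2) • ContinuousLinearMap.fst ℝ ℝ ℝ) p := by
    have h := ((Real.hasDerivAt_sqrt hp.ne').inv hs.ne').comp_hasFDerivAt p
      (hasFDerivAt_fst (𝕜 := ℝ) (E := ℝ) (F := ℝ) (p := p))
    refine h.congr_fderiv ?_
    congr 1
    field_simp
  have h2 : HasFDerivAt (fun q : ℝ × ℝ => q.2) (ContinuousLinearMap.snd ℝ ℝ ℝ) p := hasFDerivAt_snd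
  have h3 := (h1.pow m).mul ((((h2.mul h1).pow 2).neg.mul_const (1 / 4)).exp)
  refine (h3.congr_fderiv ?_).congr_of_eventuallyEq ?_
  · ext
    · simp [kapDeriv, kap]
      rcases m with _ | m
      · simp; ring_nf
      · simp; ring_nf
    · simp [kapDeriv, kap]
      ring_nf
  · filter_upwards with q
    simp [kap]
    left; ring_nf

/-- At `τ ≤ 0` the derivative is zero: `kap m = τ² kap (m + 4)` for `τ > 0`, and the second factor
is bounded while `y` stays away from `0`, so the kernel is quadratically small. Thus the extension
by zero to past times stays differentiable. -/
theorem hasFDerivAt_kap_of_ne {m : ℕ} (hm : m ≠ 0) {p : ℝ × ℝ} (hp : p.2 ≠ 0) :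
    HasFDerivAt (fun q : ℝ × ℝ => kap m q.1 q.2) (kapDeriv m p.1 p.2) p := by
  rcases lt_or_ge 0 p.1 with h0 | h0
  · exact hasFDerivAt_kap_of_pos m h0
  have hz : kapDeriv m p.1 p.2 = 0 := by
    simp [kapDeriv, kap_of_nonpos (show m + 2 ≠ 0 by omega) h0,
      kap_of_nonpos (show m + 4 ≠ 0 by omega) h0]
  rw [hz]
  obtain ⟨C, hC, h⟩ := exists_kap_le (m + 4) (δ := |p.2| / 2) (by positivity)
  refine Asymptotics.IsBigO.hasFDerivAt (n := 2) ?_ one_lt_two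
  refine Asymptotics.IsBigO.of_bound C ?_
  have : ∀ᶠ q : ℝ × ℝ in 𝓝 p, |p.2| / 2 < |q.2| :=
    (continuous_snd.abs.tendsto p).eventually (lt_mem_nhds (half_lt_self (by positivity)))
  filter_upwards [this] with q hq
  rw [Real.norm_of_nonneg (kap_nonneg _ _ _), Real.norm_of_nonneg (by positivity)]
  rcases le_or_gt q.1 0 with h1 | h1
  · rw [kap_of_nonpos hm h1]; positivity
  have hs : 0 < √q.1 := Real.sqrt_pos.2 h1
  have e : kap m q.1 q.2 = q.1 ^ 2 * kap (m + 4) q.1 q.2 := by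
    rw [add_comm m, kap_add]
    have : q.1 ^ 2 = √q.1 ^ 4 := by
      rw [show 4 = 2 * 2 by norm_num, pow_mul, Real.sq_sqrt h1.le]
    rw [this]; field_simp
  rw [e, mul_comm]
  refine mul_le_mul (h _ _ (Or.inl hq.le)) ?_ (by positivity) hC.le
  refine pow_le_pow_left₀ h1.le ?_ 2
  calc q.1 ≤ |(q - p).1| := by rw [Prod.fst_sub]; exact (by linarith : q.1 ≤ q.1 - p.1).trans (le_abs_self _)
    _ ≤ ‖q - p‖ := norm_fst_le (q - p)

end SteadyHeat

namespace SteadyHeat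

open Filter Topology

/-! ### Heat potentials -/

/-- The potential with kernel `kap m` and density `φ`. -/
noncomputable def pot (m : ℕ) (φ : ℝ → ℝ) (t y : ℝ) : ℝ := ∫ s, kap m (t - s) y * φ s

/-- Near each point `(t, y)` of the open set `Ω`, the values `φ s` that contribute to the potentials
are those for which `y` or `t - s` stays away from `0`. -/
structure Admissible (φ : ℝ → ℝ) (Ω : Set (ℝ × ℝ)) : Prop where
  measurable : Measurable φ
  bounded : ∃ B, ∀ s, |φ s| ≤ B
  isOpen : IsOpen Ω
  away : ∀ p ∈ Ω, ∃ N ∈ 𝓝 p, ∃ δ > 0, ∀ q ∈ N, ∀ s, φ s ≠ 0 → δ ≤ |q.2| ∨ δ ≤ q.1 - s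

theorem integrable_weight : Integrable fun s : ℝ => (1 + |s|) ^ (-(3 / 2) : ℝ) :=
  integrable_one_add_norm (E := ℝ) (r := 3 / 2) (by norm_num)

/-- This is Peetre's inequality: `1 + |s| ≤ (1 + |t|) (1 + |t - s|)`. It makes the dominating weight
independent of `t` on bounded sets. -/
theorem weight_sub_le (t s : ℝ) :
    (1 + |t - s|) ^ (-(3 / 2) : ℝ) ≤ (1 + |t|) ^ (3 / 2 : ℝ) * (1 + |s|) ^ (-(3 / 2) : ℝ) := by
  rw [Real.rpow_neg (by positivity), Real.rpow_neg (by positivity), ← div_eq_mul_inv,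
    le_div_iff₀ (by positivity), inv_mul_le_iff₀ (by positivity),
    ← Real.mul_rpow (by positivity) (by positivity)]
  refine Real.rpow_le_rpow (by positivity) ?_ (by norm_num)
  have h : |s| ≤ |t| + |t - s| := by
    have := abs_sub t (t - s)
    simpa using this
  nlinarith [abs_nonneg t, abs_nonneg (t - s)]

theorem exists_kap_sub_mul_le {m : ℕ} (hm : 3 ≤ m) {δ B R : ℝ} (hδ : 0 < δ) (hB : 0 ≤ B) :
    ∃ C, 0 ≤ C ∧ ∀ t y s f : ℝ, |t| ≤ R → |f| ≤ B → (f ≠ 0 → δ ≤ |y| ∨ δ ≤ t - s) →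
      kap m (t - s) y * |f| ≤ C * (1 + |s|) ^ (-(3 / 2) : ℝ) := by
  obtain ⟨C, hC, h⟩ := exists_kap_le_rpow hm hδ
  refine ⟨C * (1 + |R|) ^ (3 / 2 : ℝ) * B, by positivity, fun t y s f ht hf hne => ?_⟩
  by_cases h0 : f = 0
  · simp only [h0, abs_zero, mul_zero]; positivity
  have h1 := h (t - s) y (hne h0)
  have h2 := weight_sub_le t s
  have h3 : (1 + |t|) ^ (3 / 2 : ℝ) ≤ (1 + |R|) ^ (3 / 2 : ℝ) :=
    Real.rpow_le_rpow (by positivity) (by linarith [le_abs_self R]) (by norm_num)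
  calc kap m (t - s) y * |f|
      ≤ (C * ((1 + |R|) ^ (3 / 2 : ℝ) * (1 + |s|) ^ (-(3 / 2) : ℝ))) * B := by
        refine mul_le_mul (h1.trans ?_) hf (abs_nonneg _) (by positivity)
        gcongr
        exact h2.trans (by gcongr)
    _ = _ := by ring

namespace Admissible

variable {φ : ℝ → ℝ} {Ω : Set (ℝ × ℝ)}

/-- One neighbourhood serves all indices `m ≥ 3`, which is what domination of the kernel and of its
derivative requires. -/
theorem local_bound (h : Admissible φ Ω) {p : ℝ × ℝ} (hp : p ∈ Ω) :
    ∃ N ∈ 𝓝 p, (∀ q ∈ N, ∀ s, φ s ≠ 0 → q.2 ≠ 0 ∨ 0 < q.1 - s) ∧ (∀ q ∈ N, |q.2| ≤ |p.2| + 1) ∧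
      ∀ m : ℕ, 3 ≤ m → ∃ C, 0 ≤ C ∧ ∀ q ∈ N, ∀ s,
        kap m (q.1 - s) q.2 * |φ s| ≤ C * (1 + |s|) ^ (-(3 / 2) : ℝ) := by
  obtain ⟨N, hN, δ, hδ, haway⟩ := h.away p hp
  obtain ⟨B, hB⟩ := h.bounded
  have hB0 : 0 ≤ B := (abs_nonneg _).trans (hB 0)
  have hball : ∀ q ∈ Metric.ball p 1, |q.1| ≤ |p.1| + 1 ∧ |q.2| ≤ |p.2| + 1 := by
    intro q hq
    rw [Metric.mem_ball, dist_eq_norm] at hq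
    have h1 := (norm_fst_le (q - p)).trans hq.le
    have h2 := (norm_snd_le (q - p)).trans hq.le
    rw [Real.norm_eq_abs, Prod.fst_sub] at h1
    rw [Real.norm_eq_abs, Prod.snd_sub] at h2
    have h3 := abs_sub_abs_le_abs_sub q.1 p.1
    have h4 := abs_sub_abs_le_abs_sub q.2 p.2
    constructor <;> linarith
  refine ⟨N ∩ Metric.ball p 1, inter_mem hN (Metric.ball_mem_nhds _ one_pos), ?_,
    fun q hq => (hball q hq.2).2, fun m hm => ?_⟩
  · intro q hq s hs
    rcases haway q hq.1 s hs with h | h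
    · left; intro h0; rw [h0, abs_zero] at h; linarith
    · right; linarith
  · obtain ⟨C, hC, hbd⟩ := exists_kap_sub_mul_le hm (R := |p.1| + 1) hδ hB0
    exact ⟨C, hC, fun q hq s => hbd _ _ _ _ (hball q hq.2).1 (hB s) (haway q hq.1 s)⟩

theorem aestronglyMeasurable (h : Admissible φ Ω) (m : ℕ) (t y : ℝ) :
    AEStronglyMeasurable fun s => kap m (t - s) y * φ s := by
  have := h.measurable
  have h2 : Measurable fun s => kap m (t - s) y :=
    (measurable_kap m).comp (f := fun s : ℝ => (t - s, y)) (by fun_prop)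
  exact (h2.mul this).aestronglyMeasurable

theorem integrable (h : Admissible φ Ω) {m : ℕ} (hm : 3 ≤ m) {p : ℝ × ℝ} (hp : p ∈ Ω) :
    Integrable fun s => kap m (p.1 - s) p.2 * φ s := by
  obtain ⟨N, hN, -, -, hb⟩ := h.local_bound hp
  obtain ⟨C, -, hC⟩ := hb m hm
  refine (integrable_weight.const_mul C).mono' (h.aestronglyMeasurable m _ _) ?_
  refine Eventually.of_forall fun s => ?_
  rw [norm_mul, Real.norm_of_nonneg (kap_nonneg _ _ _)]
  exact hC p (mem_of_mem_nhds hN) s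

theorem hasFDerivAt_pot (h : Admissible φ Ω) {m : ℕ} (hm : 3 ≤ m) {p : ℝ × ℝ} (hp : p ∈ Ω) :
    HasFDerivAt (fun q : ℝ × ℝ => pot m φ q.1 q.2)
      ((-(m / 2) * pot (m + 2) φ p.1 p.2 + p.2 ^ 2 / 4 * pot (m + 4) φ p.1 p.2) •
          ContinuousLinearMap.fst ℝ ℝ ℝ +
        (-(p.2 / 2) * pot (m + 2) φ p.1 p.2) • ContinuousLinearMap.snd ℝ ℝ ℝ) p := by
  obtain ⟨N, hN, hne, hy, hb⟩ := h.local_bound hp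
  obtain ⟨C₂, hC₂, h₂⟩ := hb (m + 2) (by omega)
  obtain ⟨C₄, hC₄, h₄⟩ := hb (m + 4) (by omega)
  set Y := |p.2| + 1
  have hY : 0 ≤ Y := by positivity
  have i2 := h.integrable (m := m + 2) (by omega) hp
  have i4 := h.integrable (m := m + 4) (by omega) hp
  have key := hasFDerivAt_integral_of_dominated_of_fderiv_le (μ := volume) (𝕜 := ℝ)
    (F := fun (q : ℝ × ℝ) s => kap m (q.1 - s) q.2 * φ s)
    (F' := fun (q : ℝ × ℝ) s => φ s • kapDeriv m (q.1 - s) q.2) (x₀ := p) (s := N)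
    (bound := fun s => (m / 2 * C₂ + Y ^ 2 / 4 * C₄ + Y / 2 * C₂) * (1 + |s|) ^ (-(3 / 2) : ℝ))
    hN (Eventually.of_forall fun q => h.aestronglyMeasurable m _ _) (h.integrable hm hp)
    ?_ ?_ (integrable_weight.const_mul _) ?_
  · refine key.congr_fderiv ?_
    have e : ∀ s, φ s • kapDeriv m (p.1 - s) p.2 =
        (-(m / 2) * (kap (m + 2) (p.1 - s) p.2 * φ s) +
          p.2 ^ 2 / 4 * (kap (m + 4) (p.1 - s) p.2 * φ s)) • ContinuousLinearMap.fst ℝ ℝ ℝ +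
        (-(p.2 / 2) * (kap (m + 2) (p.1 - s) p.2 * φ s)) • ContinuousLinearMap.snd ℝ ℝ ℝ := by
      intro s
      rw [kapDeriv, smul_add, smul_smul, smul_smul]
      congr 2 <;> ring
    simp_rw [e]
    rw [integral_add, integral_smul_const, integral_smul_const, integral_add, integral_const_mul,
      integral_const_mul, integral_const_mul]
    · rfl
    · exact i2.const_mul _
    · exact i4.const_mul _
    · exact ((i2.const_mul _).add (i4.const_mul _)).smul_const _
    · exact (i2.const_mul _).smul_const _
  · have m2 := h.aestronglyMeasurable (m + 2) p.1 p.2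
    have m4 := h.aestronglyMeasurable (m + 4) p.1 p.2
    have := (((m2.const_mul (-(m / 2 : ℝ))).add (m4.const_mul (p.2 ^ 2 / 4))).smul_const
      (ContinuousLinearMap.fst ℝ ℝ ℝ)).add
      ((m2.const_mul (-(p.2 / 2))).smul_const (ContinuousLinearMap.snd ℝ ℝ ℝ))
    refine this.congr (Eventually.of_forall fun s => ?_)
    simp only [kapDeriv, Pi.add_apply, smul_add, smul_smul]
    congr 2 <;> ring
  · refine Eventually.of_forall fun s q hq => ?_
    have k2 := kap_nonneg (m + 2) (q.1 - s) q.2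
    have k4 := kap_nonneg (m + 4) (q.1 - s) q.2
    have b2 := h₂ q hq s
    have b4 := h₄ q hq s
    have hyq := hy q hq
    rw [norm_smul, Real.norm_eq_abs]
    have e1 : ‖kapDeriv m (q.1 - s) q.2‖ ≤
        m / 2 * kap (m + 2) (q.1 - s) q.2 + Y ^ 2 / 4 * kap (m + 4) (q.1 - s) q.2 +
          Y / 2 * kap (m + 2) (q.1 - s) q.2 := by
      refine (norm_add_le _ _).trans (add_le_add ?_ ?_)
      · rw [norm_smul]
        refine (mul_le_of_le_one_right (norm_nonneg _)
          (ContinuousLinearMap.norm_fst_le ℝ ℝ ℝ)).trans ?_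
        refine (norm_add_le _ _).trans (add_le_add (le_of_eq ?_) ?_)
        · rw [norm_mul, Real.norm_of_nonneg k2, norm_neg, Real.norm_of_nonneg (by positivity)]
        · rw [norm_mul, Real.norm_of_nonneg k4, Real.norm_of_nonneg (by positivity), ← sq_abs q.2]
          gcongr
      · rw [norm_smul]
        refine (mul_le_of_le_one_right (norm_nonneg _)
          (ContinuousLinearMap.norm_snd_le ℝ ℝ ℝ)).trans ?_
        rw [norm_mul, Real.norm_of_nonneg k2, norm_neg, norm_div, Real.norm_eq_abs,
          Real.norm_eq_abs, abs_two]
        gcongr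
    calc |φ s| * ‖kapDeriv m (q.1 - s) q.2‖ ≤ |φ s| * _ :=
          mul_le_mul_of_nonneg_left e1 (abs_nonneg _)
      _ = m / 2 * (kap (m + 2) (q.1 - s) q.2 * |φ s|) +
            Y ^ 2 / 4 * (kap (m + 4) (q.1 - s) q.2 * |φ s|) +
            Y / 2 * (kap (m + 2) (q.1 - s) q.2 * |φ s|) := by ring
      _ ≤ m / 2 * (C₂ * (1 + |s|) ^ (-(3 / 2) : ℝ)) + Y ^ 2 / 4 * (C₄ * (1 + |s|) ^ (-(3 / 2) : ℝ)) +
            Y / 2 * (C₂ * (1 + |s|) ^ (-(3 / 2) : ℝ)) := by gcongr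
      _ = _ := by ring
  · refine Eventually.of_forall fun s q hq => ?_
    by_cases h0 : φ s = 0
    · simp only [h0, mul_zero, zero_smul]
      exact hasFDerivAt_const 0 q
    have hk : HasFDerivAt (fun q : ℝ × ℝ => kap m q.1 q.2) (kapDeriv m (q.1 - s) q.2)
        (q.1 - s, q.2) := by
      rcases hne q hq s h0 with h | h
      · exact hasFDerivAt_kap_of_ne (p := (q.1 - s, q.2)) (by omega) h
      · exact hasFDerivAt_kap_of_pos (p := (q.1 - s, q.2)) m h
    have hs : HasFDerivAt (fun q : ℝ × ℝ => (q.1 - s, q.2)) (ContinuousLinearMap.id ℝ (ℝ × ℝ)) q := by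
      refine ((hasFDerivAt_id q).sub_const (s, (0 : ℝ))).congr_of_eventuallyEq ?_
      filter_upwards with r
      simp [Prod.ext_iff]
    have := (hk.comp q hs).mul_const (φ s)
    simpa using this

/-- The gradient of the potential of index `m` is a polynomial combination of those of indices `m +
2` and `m + 4`, so the induction runs over all `m` at once. -/
theorem contDiffOn_pot (h : Admissible φ Ω) {m : ℕ} (hm : 3 ≤ m) :
    ContDiffOn ℝ (⊤ : ℕ∞) (fun q : ℝ × ℝ => pot m φ q.1 q.2) Ω := by
  refine contDiffOn_infty.2 fun n => ?_
  induction n generalizing m with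
  | zero =>
    exact contDiffOn_zero.2 fun p hp => (h.hasFDerivAt_pot hm hp).continuousAt.continuousWithinAt
  | succ n ih =>
    refine (contDiffOn_succ_iff_fderiv_of_isOpen h.isOpen).2 ⟨fun p hp =>
      (h.hasFDerivAt_pot hm hp).differentiableAt.differentiableWithinAt, fun h => absurd h (WithTop.natCast_ne_top n), ?_⟩
    have i2 := ih (m := m + 2) (by omega)
    have i4 := ih (m := m + 4) (by omega)
    refine ContDiffOn.congr ?_ fun p hp => (h.hasFDerivAt_pot hm hp).fderiv
    fun_prop

end Admissible

end SteadyHeat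

namespace SteadyHeat

open Filter Topology

/-! ### Analyticity of the potentials in the space variable -/

/-- The kernel `kap m` at a complex space variable. -/
noncomputable def ckap (m : ℕ) (τ : ℝ) (z : ℂ) : ℂ :=
  (((√τ)⁻¹ : ℝ) : ℂ) ^ m * Complex.exp (-(z * ((√τ)⁻¹ : ℝ)) ^ 2 / 4)

theorem ckap_ofReal (m : ℕ) (τ y : ℝ) : ckap m τ y = (kap m τ y : ℂ) := by
  simp [ckap, kap]

/-- The modulus of the Gaussian sees only `Re z²`, so the real kernel bounds carry over to the
sector `Re z² > 0`. -/
theorem norm_ckap (m : ℕ) (τ : ℝ) {z : ℂ} (hz : 0 ≤ (z ^ 2).re) :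
    ‖ckap m τ z‖ = kap m τ √(z ^ 2).re := by
  have h : (-(z * ((√τ)⁻¹ : ℝ)) ^ 2 / 4).re = -(√(z ^ 2).re * (√τ)⁻¹) ^ 2 / 4 := by
    rw [mul_pow, mul_pow, Real.sq_sqrt hz, ← Complex.ofReal_pow, neg_div, Complex.neg_re,
      show (4 : ℂ) = ((4 : ℝ) : ℂ) by norm_num, Complex.div_ofReal_re, Complex.re_mul_ofReal,
      neg_div]
  rw [ckap, kap, norm_mul, Complex.norm_exp, h, norm_pow, Complex.norm_real,
    Real.norm_of_nonneg (by positivity)]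

theorem hasDerivAt_ckap (m : ℕ) (τ : ℝ) (z : ℂ) :
    HasDerivAt (ckap m τ) (-(z / 2) * ckap (m + 2) τ z) z := by
  have h := ((((((hasDerivAt_id z).mul_const (((√τ)⁻¹ : ℝ) : ℂ)).pow 2).neg.div_const 4).cexp).const_mul
    ((((√τ)⁻¹ : ℝ) : ℂ) ^ m))
  refine h.congr_deriv ?_
  simp [ckap]
  ring

theorem measurable_ckap (m : ℕ) (t : ℝ) (z : ℂ) : Measurable fun s : ℝ => ckap m (t - s) z := by
  unfold ckap; fun_prop

theorem differentiableAt_integral_ckap {φ : ℝ → ℝ} (hφ : Measurable φ) {B : ℝ}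
    (hB : ∀ s, |φ s| ≤ B) (t : ℝ) {z : ℂ} (hz : 0 < (z ^ 2).re) :
    DifferentiableAt ℂ (fun z => ∫ s, ckap 3 (t - s) z * (φ s : ℂ)) z := by
  have hB0 : 0 ≤ B := (abs_nonneg _).trans (hB 0)
  set δ := √((z ^ 2).re / 2)
  have hδ : 0 < δ := Real.sqrt_pos.2 (by positivity)
  obtain ⟨C₃, hC₃, h₃⟩ := exists_kap_sub_mul_le (m := 3) le_rfl (R := |t|) hδ hB0
  obtain ⟨C₅, hC₅, h₅⟩ := exists_kap_sub_mul_le (m := 5) (by norm_num) (R := |t|) hδ hB0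
  have hN : {w : ℂ | (z ^ 2).re / 2 < (w ^ 2).re ∧ ‖w‖ < ‖z‖ + 1} ∈ 𝓝 z := by
    have c1 : Continuous fun w : ℂ => (w ^ 2).re := by fun_prop
    have c2 : Continuous fun w : ℂ => ‖w‖ := by fun_prop
    filter_upwards [(c1.tendsto z).eventually (lt_mem_nhds (half_lt_self hz)),
      (c2.tendsto z).eventually (gt_mem_nhds (lt_add_one ‖z‖))] with w h1 h2 using ⟨h1, h2⟩
  have bd : ∀ (m : ℕ) (C : ℝ), (∀ t' y s f : ℝ, |t'| ≤ |t| → |f| ≤ B →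
      (f ≠ 0 → δ ≤ |y| ∨ δ ≤ t' - s) → kap m (t' - s) y * |f| ≤ C * (1 + |s|) ^ (-(3 / 2) : ℝ)) →
      ∀ w : ℂ, (z ^ 2).re / 2 < (w ^ 2).re → ∀ s,
        ‖ckap m (t - s) w * (φ s : ℂ)‖ ≤ C * (1 + |s|) ^ (-(3 / 2) : ℝ) := by
    intro m C h w hw s
    rw [norm_mul, norm_ckap m _ (by linarith), Complex.norm_real, Real.norm_eq_abs]
    refine h _ _ _ _ le_rfl (hB s) fun _ => Or.inl ?_
    rw [abs_of_nonneg (Real.sqrt_nonneg _)]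
    exact Real.sqrt_le_sqrt hw.le
  have meas : ∀ m w, AEStronglyMeasurable fun s => ckap m (t - s) w * (φ s : ℂ) := fun m w =>
    ((measurable_ckap m t w).mul (Complex.measurable_ofReal.comp hφ)).aestronglyMeasurable
  have key := hasDerivAt_integral_of_dominated_loc_of_deriv_le (μ := volume) (𝕜 := ℂ)
    (F := fun w s => ckap 3 (t - s) w * (φ s : ℂ))
    (F' := fun w s => -(w / 2) * (ckap 5 (t - s) w * (φ s : ℂ))) (x₀ := z)
    (bound := fun s => (‖z‖ + 1) / 2 * (C₅ * (1 + |s|) ^ (-(3 / 2) : ℝ)))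
    hN (Eventually.of_forall fun w => meas 3 w)
    ((integrable_weight.const_mul C₃).mono' (meas 3 z)
      (Eventually.of_forall (bd 3 C₃ h₃ z (by linarith))))
    ((meas 5 z).const_mul _) ?_ ((integrable_weight.const_mul _).const_mul _) ?_
  · exact key.2.differentiableAt
  · refine Eventually.of_forall fun s w hw => ?_
    rw [norm_mul]
    refine mul_le_mul ?_ (bd 5 C₅ h₅ w hw.1 s) (norm_nonneg _) (by positivity)
    rw [norm_neg, norm_div, Complex.norm_two]
    linarith [hw.2]
  · refine Eventually.of_forall fun s w _ => ?_
    refine ((hasDerivAt_ckap 3 (t - s) w).mul_const (φ s : ℂ)).congr_deriv ?_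
    ring

theorem analyticAt_pot {φ : ℝ → ℝ} (hφ : Measurable φ) {B : ℝ} (hB : ∀ s, |φ s| ≤ B) (t : ℝ)
    {y : ℝ} (hy : y ≠ 0) : AnalyticAt ℝ (fun y => pot 3 φ t y) y := by
  have hS : {w : ℂ | 0 < (w ^ 2).re} ∈ 𝓝 (y : ℂ) := by
    refine (isOpen_lt continuous_const (by fun_prop)).mem_nhds ?_
    simp only [mem_ofPred_eq, ← Complex.ofReal_pow, Complex.ofReal_re]
    positivity
  have h1 : AnalyticAt ℂ (fun z => ∫ s, ckap 3 (t - s) z * (φ s : ℂ)) (y : ℂ) :=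
    DifferentiableOn.analyticAt (fun z hz =>
      (differentiableAt_integral_ckap hφ hB t hz).differentiableWithinAt) hS
  refine h1.re_ofReal.congr (Eventually.of_forall fun x => ?_)
  simp only [ckap_ofReal, ← Complex.ofReal_mul]
  rw [integral_complex_ofReal, Complex.ofReal_re, pot]

/-! ### Bounded solutions in the half-line -/

theorem integrable_kap_three_one : Integrable fun s => kap 3 s 1 := by
  obtain ⟨C, -, h⟩ := exists_kap_le_rpow (m := 3) le_rfl one_pos
  refine (integrable_weight.const_mul C).mono'
    ((measurable_kap 3).comp (f := fun s : ℝ => (s, (1 : ℝ))) (by fun_prop)).aestronglyMeasurable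
    (Eventually.of_forall fun s => ?_)
  rw [Real.norm_of_nonneg (kap_nonneg _ _ _)]
  exact h s 1 (by simp)

/-- The total mass of the kernel `kap 3 · 1`. -/
noncomputable def kapMass : ℝ := ∫ s, kap 3 s 1

theorem kapMass_pos : 0 < kapMass := by
  rw [kapMass, integral_pos_iff_support_of_nonneg (fun s => kap_nonneg 3 s 1)
    integrable_kap_three_one]
  refine lt_of_lt_of_le ?_ (measure_mono (s := Ioi (0 : ℝ)) fun s hs => (kap_pos hs 1).ne')
  simp

/-- The probability density of the time that a Brownian path takes to leave the half-line. -/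
noncomputable def dens (s : ℝ) : ℝ := kap 3 s 1 / kapMass

theorem dens_nonneg (s : ℝ) : 0 ≤ dens s := div_nonneg (kap_nonneg _ _ _) kapMass_pos.le

theorem dens_pos {s : ℝ} (hs : 0 < s) : 0 < dens s := div_pos (kap_pos hs 1) kapMass_pos

theorem dens_of_nonpos {s : ℝ} (hs : s ≤ 0) : dens s = 0 := by
  rw [dens, kap_of_nonpos three_ne_zero hs, zero_div]

theorem integrable_dens : Integrable dens := integrable_kap_three_one.div_const _

theorem integral_dens : ∫ s, dens s = 1 := by
  simp only [dens]
  rw [integral_div]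
  exact div_self kapMass_pos.ne'

/-- The bounded solution of the heat equation on the half-line `y ≥ 0` with boundary values `φ`. -/
noncomputable def halfLine (φ : ℝ → ℝ) (t y : ℝ) : ℝ := ∫ s, dens s * φ (t - y ^ 2 * s)

theorem halfLine_zero (φ : ℝ → ℝ) (t : ℝ) : halfLine φ t 0 = φ t := by
  simp [halfLine, integral_mul_const, integral_dens]

/-- Substitute `τ = y² s` and use the parabolic scaling of the kernel. The average form gives bounds
and continuity up to `y = 0`; the potential form gives smoothness for `y > 0`. -/
theorem halfLine_eq_pot (φ : ℝ → ℝ) (t : ℝ) {y : ℝ} (hy : 0 < y) :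
    halfLine φ t y = y / kapMass * pot 3 φ t y := by
  have h1 : pot 3 φ t y = ∫ τ, kap 3 τ y * φ (t - τ) := by
    rw [pot, ← integral_sub_left_eq_self (fun τ => kap 3 τ y * φ (t - τ)) volume t]
    simp
  have h2 := Measure.integral_comp_mul_left (fun τ => kap 3 τ y * φ (t - τ)) (y ^ 2)
  have h3 : ∀ s, kap 3 (y ^ 2 * s) y = (y ^ 3)⁻¹ * kap 3 s 1 := by
    intro s
    simp only [kap]
    rw [Real.sqrt_mul (by positivity), Real.sqrt_sq hy.le, mul_inv, mul_inv_cancel_left₀ hy.ne',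
      one_mul, mul_pow, inv_pow]
    ring
  simp only [h3] at h2
  rw [← h1, abs_of_nonneg (by positivity), smul_eq_mul] at h2
  have h4 : ∫ s, (y ^ 3)⁻¹ * kap 3 s 1 * φ (t - y ^ 2 * s) =
      (y ^ 3)⁻¹ * kapMass * halfLine φ t y := by
    rw [halfLine, ← integral_const_mul]
    refine integral_congr_ae (Eventually.of_forall fun s => ?_)
    simp only [dens]
    field_simp [kapMass_pos.ne']
  rw [h4] at h2
  have := kapMass_pos
  field_simp at h2 ⊢
  linarith

theorem integrable_halfLine {φ : ℝ → ℝ} (hφ : Measurable φ) {B : ℝ} (hB : ∀ s, |φ s| ≤ B)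
    (t y : ℝ) : Integrable fun s => dens s * φ (t - y ^ 2 * s) := by
  refine integrable_dens.mul_bdd (c := B) (Measurable.aestronglyMeasurable (by fun_prop))
    (Eventually.of_forall fun s => hB _)

theorem abs_halfLine_le {φ : ℝ → ℝ} {B : ℝ} (hB : ∀ s, |φ s| ≤ B) (t y : ℝ) :
    |halfLine φ t y| ≤ B := by
  have h := norm_integral_le_of_norm_le (f := fun s => dens s * φ (t - y ^ 2 * s))
    (integrable_dens.mul_const B) (Eventually.of_forall fun s => by
      rw [norm_mul, Real.norm_of_nonneg (dens_nonneg s)]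
      exact mul_le_mul_of_nonneg_left (hB _) (dens_nonneg s))
  rwa [integral_mul_const, integral_dens, one_mul] at h

theorem continuous_halfLine {φ : ℝ → ℝ} (hφ : Continuous φ) {B : ℝ} (hB : ∀ s, |φ s| ≤ B) :
    Continuous fun p : ℝ × ℝ => halfLine φ p.1 p.2 := by
  unfold halfLine
  refine continuous_of_dominated (bound := fun s => dens s * B) (fun p =>
    (integrable_halfLine hφ.measurable hB p.1 p.2).aestronglyMeasurable)
    (fun p => Eventually.of_forall fun s => ?_) (integrable_dens.mul_const B)
    (Eventually.of_forall fun s => by fun_prop)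
  rw [norm_mul, Real.norm_of_nonneg (dens_nonneg s)]
  exact mul_le_mul_of_nonneg_left (hB _) (dens_nonneg s)

/-- The derivative falls on the density and not on the kernel, so the formula holds up to `y = 0`.
-/
theorem hasDerivAt_halfLine {φ φ' : ℝ → ℝ} (h : ∀ s, HasDerivAt φ (φ' s) s) (hφ' : Measurable φ')
    {B B' : ℝ} (hB : ∀ s, |φ s| ≤ B) (hB' : ∀ s, |φ' s| ≤ B') (t y : ℝ) :
    HasDerivAt (fun t => halfLine φ t y) (halfLine φ' t y) t := by
  have hφ : Measurable φ := (continuous_iff_continuousAt.2 fun s => (h s).continuousAt).measurable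
  refine (hasDerivAt_integral_of_dominated_loc_of_deriv_le (μ := volume) (𝕜 := ℝ)
    (F := fun t s => dens s * φ (t - y ^ 2 * s)) (F' := fun t s => dens s * φ' (t - y ^ 2 * s))
    (bound := fun s => dens s * B') (s := univ) univ_mem
    (Eventually.of_forall fun t => (integrable_halfLine hφ hB t y).aestronglyMeasurable)
    (integrable_halfLine hφ hB t y) (integrable_halfLine hφ' hB' t y).aestronglyMeasurable
    (Eventually.of_forall fun s r _ => ?_) (integrable_dens.mul_const B')
    (Eventually.of_forall fun s r _ => ?_)).2
  · rw [norm_mul, Real.norm_of_nonneg (dens_nonneg s)]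
    exact mul_le_mul_of_nonneg_left (hB' _) (dens_nonneg s)
  · exact ((h _).comp_sub_const r (y ^ 2 * s)).const_mul _

theorem halfLine_add {φ ψ : ℝ → ℝ} (hφ : Measurable φ) (hψ : Measurable ψ) {B C : ℝ}
    (hB : ∀ s, |φ s| ≤ B) (hC : ∀ s, |ψ s| ≤ C) (t y : ℝ) :
    halfLine (fun s => φ s + ψ s) t y = halfLine φ t y + halfLine ψ t y := by
  rw [halfLine, halfLine, halfLine,
    ← integral_add (integrable_halfLine hφ hB t y) (integrable_halfLine hψ hC t y)]
  simp only [mul_add]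

/-- Causality: `dens` vanishes on `s ≤ 0`, so only the past of the density matters. -/
theorem halfLine_congr {φ ψ : ℝ → ℝ} {t : ℝ} (h : ∀ s ≤ t, φ s = ψ s) (y : ℝ) :
    halfLine φ t y = halfLine ψ t y := by
  refine integral_congr_ae (Eventually.of_forall fun s => ?_)
  rcases le_total s 0 with hs | hs
  · simp only [dens_of_nonpos hs, zero_mul]
  · simp only [h (t - y ^ 2 * s) (by nlinarith [sq_nonneg y])]

end SteadyHeat

namespace SteadyHeat

open Filter Topology BoundedContinuousFunction

/-! ### The boundary density -/

theorem abs_apply_le (f : ℝ →ᵇ ℝ) (t : ℝ) : |f t| ≤ ‖f‖ := f.norm_coe_le_norm t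

/-- The operator that sends `φ` to the values at distance `2` from the boundary of the solution on
the half-line with boundary values `φ`. -/
noncomputable def transfer : (ℝ →ᵇ ℝ) →L[ℝ] (ℝ →ᵇ ℝ) :=
  LinearMap.mkContinuous
    { toFun := fun f => BoundedContinuousFunction.ofNormedAddCommGroup (fun t => halfLine f t 2)
        ((continuous_halfLine f.continuous (abs_apply_le f)).comp (Continuous.prodMk_left 2)) ‖f‖
        fun t => abs_halfLine_le (abs_apply_le f) t 2
      map_add' := fun f g => by
        ext t
        exact halfLine_add f.continuous.measurable g.continuous.measurable (abs_apply_le f)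
          (abs_apply_le g) t 2
      map_smul' := fun c f => by
        ext t
        simp [halfLine, ← integral_const_mul, mul_left_comm] }
    1 fun f => by
      rw [one_mul]
      exact (BoundedContinuousFunction.norm_le (norm_nonneg f)).2
        fun t => abs_halfLine_le (abs_apply_le f) t 2

theorem transfer_apply (f : ℝ →ᵇ ℝ) (t : ℝ) : transfer f t = halfLine f t 2 := rfl

theorem transfer_one : transfer 1 = 1 := by
  ext t
  simp [transfer_apply, halfLine, integral_dens]

theorem transfer_nonneg {f : ℝ →ᵇ ℝ} (hf : ∀ t, 0 ≤ f t) (t : ℝ) : 0 ≤ transfer f t :=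
  integral_nonneg fun s => mul_nonneg (dens_nonneg s) (hf _)

theorem continuousOn_dens : ContinuousOn dens (Ioi 0) := fun s hs => by
  have h := (hasFDerivAt_kap_of_pos 3 (p := (s, 1)) hs).continuousAt
  have h2 : ContinuousAt (fun s : ℝ => (s, (1 : ℝ))) s := by fun_prop
  exact ((ContinuousAt.comp (f := fun s : ℝ => (s, (1 : ℝ))) h h2).div_const _).continuousWithinAt

/-- `transfer` dominates a multiple of a moving average. -/
theorem exists_le_transfer : ∃ α, 0 < α ∧ ∀ f : ℝ →ᵇ ℝ, (∀ t, 0 ≤ f t) → ∀ t,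
    α * ∫ s in (1 / 4 : ℝ)..2, f (t - s) ≤ transfer f t := by
  -- At distance `2` the time lag is `4 s`, so `s ∈ [1/16, 1/2]` corresponds to lags in `[1/4, 2]`;
  -- the `4` dividing `dens s₀` below is the Jacobian.
  obtain ⟨s₀, hs₀, hmin⟩ := (isCompact_Icc (a := (1 / 16 : ℝ)) (b := 1 / 2)).exists_isMinOn
    ⟨1 / 16, by norm_num⟩ (continuousOn_dens.mono fun s hs => lt_of_lt_of_le (by norm_num) hs.1)
  have hpos : 0 < dens s₀ := dens_pos (lt_of_lt_of_le (by norm_num) hs₀.1)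
  refine ⟨dens s₀ / 4, by positivity, fun f hf t => ?_⟩
  have h1 : ∫ s in (1 / 16 : ℝ)..(1 / 2), f (t - 4 * s) =
      4⁻¹ * ∫ s in (1 / 4 : ℝ)..2, f (t - s) := by
    have := intervalIntegral.integral_comp_mul_left (a := 1 / 16) (b := 1 / 2)
      (fun s => f (t - s)) (c := 4) (by norm_num)
    norm_num at this ⊢
  calc dens s₀ / 4 * ∫ s in (1 / 4 : ℝ)..2, f (t - s)
      = ∫ s in (1 / 16 : ℝ)..(1 / 2), dens s₀ * f (t - 4 * s) := by
        rw [intervalIntegral.integral_const_mul, h1]; ring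
    _ = ∫ s in Ioc (1 / 16 : ℝ) (1 / 2), dens s₀ * f (t - 4 * s) :=
        intervalIntegral.integral_of_le (by norm_num)
    _ ≤ ∫ s in Ioc (1 / 16 : ℝ) (1 / 2), dens s * f (t - 2 ^ 2 * s) := by
        refine setIntegral_mono_on ?_ ?_ measurableSet_Ioc fun s hs => ?_
        · have : Continuous fun s : ℝ => dens s₀ * f (t - 4 * s) := by fun_prop
          exact this.integrableOn_Ioc
        · exact (integrable_halfLine f.continuous.measurable (abs_apply_le f) t 2).integrableOn
        · norm_num
          exact mul_le_mul_of_nonneg_right (hmin (Ioc_subset_Icc_self hs)) (hf _)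
    _ ≤ transfer f t :=
        setIntegral_le_integral
          (integrable_halfLine f.continuous.measurable (abs_apply_le f) t 2)
          (Eventually.of_forall fun s => mul_nonneg (dens_nonneg s) (hf _))

theorem intervalIntegral_shift_mono {f : ℝ →ᵇ ℝ} (hf : ∀ t, 0 ≤ f t) {a b c d : ℝ} (hca : c ≤ a)
    (hab : a ≤ b) (hbd : b ≤ d) (t : ℝ) :
    ∫ s in a..b, f (t - s) ≤ ∫ s in c..d, f (t - s) := by
  refine intervalIntegral.integral_mono_interval hca hab hbd
    (Eventually.of_forall fun s => hf _) ?_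
  have : Continuous fun s : ℝ => f (t - s) := by fun_prop
  exact this.intervalIntegrable _ _

/-- Both `transfer` and its square dominate a multiple of the same moving average. -/
theorem exists_le_transfer_sq : ∃ ε, 0 < ε ∧ ∀ f : ℝ →ᵇ ℝ, (∀ t, 0 ≤ f t) → ∀ t,
    ε * ∫ s in (1 : ℝ)..2, f (t - s) ≤ transfer f t ∧
      ε * ∫ s in (1 : ℝ)..2, f (t - s) ≤ transfer (transfer f) t := by
  obtain ⟨α, hα, h⟩ := exists_le_transfer
  have h0 : ∀ f : ℝ →ᵇ ℝ, (∀ t, 0 ≤ f t) → ∀ t, 0 ≤ ∫ s in (1 : ℝ)..2, f (t - s) := fun f hf t =>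
    intervalIntegral.integral_nonneg (by norm_num) fun s _ => hf _
  refine ⟨min α (α ^ 2 / 4), by positivity, fun f hf t => ⟨?_, ?_⟩⟩
  · calc _ ≤ α * ∫ s in (1 : ℝ)..2, f (t - s) :=
          mul_le_mul_of_nonneg_right (min_le_left _ _) (h0 f hf t)
      _ ≤ α * ∫ s in (1 / 4 : ℝ)..2, f (t - s) :=
          mul_le_mul_of_nonneg_left (intervalIntegral_shift_mono hf (by norm_num) (by norm_num)
            le_rfl t) hα.le
      _ ≤ _ := h f hf t
  · set m := ∫ s in (1 : ℝ)..2, f (t - s)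
    -- A further lag `s ∈ [1/4, 1/2]` turns the window `[1, 2]` into `[1 - s, 2 - s]`, which still
    -- lies in `[1/4, 2]`. Averaging over these `s`, an interval of length `1/4`, gives the constant
    -- `α² / 4`.
    have h1 : ∀ s ∈ Icc (1 / 4 : ℝ) (1 / 2), α * m ≤ transfer f (t - s) := by
      intro s hs
      refine le_trans (mul_le_mul_of_nonneg_left ?_ hα.le) (h f hf (t - s))
      have e : m = ∫ r in (1 - s)..(2 - s), f (t - s - r) := by
        have := intervalIntegral.integral_comp_add_left (a := 1 - s) (b := 2 - s)
          (fun r => f (t - r)) s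
        simp only [add_sub_cancel] at this
        simp only [sub_sub, this, m]
      rw [e]
      exact intervalIntegral_shift_mono hf (by linarith [hs.2]) (by linarith) (by linarith [hs.1]) _
    have h2 : ∫ _ in (1 / 4 : ℝ)..(1 / 2), α * m ≤ ∫ s in (1 / 4 : ℝ)..(1 / 2), transfer f (t - s) := by
      refine intervalIntegral.integral_mono_on (by norm_num) (by simp) ?_ h1
      have : Continuous fun s : ℝ => transfer f (t - s) := by fun_prop
      exact this.intervalIntegrable _ _
    rw [intervalIntegral.integral_const] at h2
    calc _ ≤ α ^ 2 / 4 * m := mul_le_mul_of_nonneg_right (min_le_right _ _) (h0 f hf t)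
      _ = α * ((1 / 2 - 1 / 4 : ℝ) • (α * m)) := by rw [smul_eq_mul]; ring
      _ ≤ α * ∫ s in (1 / 4 : ℝ)..(1 / 2), transfer f (t - s) :=
          mul_le_mul_of_nonneg_left h2 hα.le
      _ ≤ α * ∫ s in (1 / 4 : ℝ)..2, transfer f (t - s) :=
          mul_le_mul_of_nonneg_left (intervalIntegral_shift_mono (transfer_nonneg hf) le_rfl
            (by norm_num) (by norm_num) t) hα.le
      _ ≤ _ := h _ (transfer_nonneg hf) t

theorem isUnit_one_sub_of_isUnit_one_sub_mul_self {R : Type*} [Ring R] {a : R}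
    (h : IsUnit (1 - a * a)) : IsUnit (1 - a) := by
  have hf : 1 - a * a = (1 - a) * (1 + a) := by noncomm_ring
  have hcomm : Commute (1 - a) (1 + a) := by
    rw [commute_iff_eq]; noncomm_ring
  exact (hcomm.isUnit_mul_iff.1 (hf ▸ h)).1

/-- With `A = (1 - K) / 2` one has `1 + K = 2 (1 - A)`, and `‖A²‖ ≤ 1 - ε / 2` makes `1 - A²`, hence
its factor `1 - A`, invertible. -/
theorem exists_add_transfer_eq (G : ℝ →ᵇ ℝ) : ∃ f : ℝ →ᵇ ℝ, f + transfer f = G := by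
  obtain ⟨ε, hε, h⟩ := exists_le_transfer_sq
  have hint : ∀ (f : ℝ →ᵇ ℝ) t, IntervalIntegrable (fun s => f (t - s)) volume 1 2 := fun f t => by
    have : Continuous fun s : ℝ => f (t - s) := by fun_prop
    exact this.intervalIntegrable _ _
  -- The lower bounds for `K (1 - f)` and `K² (1 + f)` contain the moving average of `f` with
  -- opposite signs; it cancels in the sum and leaves a gain of `2 ε` over the trivial bound `3`.
  have key : ∀ f : ℝ →ᵇ ℝ, ‖f‖ ≤ 1 → ∀ t,
      2 * transfer f t - transfer (transfer f) t ≤ 3 - 2 * ε := by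
    intro f hf t
    have hf1 : ∀ t, |f t| ≤ 1 := fun t => (abs_apply_le f t).trans hf
    have a := h (1 - f) (fun t => by
      have := (abs_le.1 (hf1 t)).2
      simpa using this) t
    have b := h (1 + f) (fun t => by
      have := (abs_le.1 (hf1 t)).1
      simp; linarith) t
    have ia : ∫ s in (1 : ℝ)..2, (1 - f) (t - s) = 1 - ∫ s in (1 : ℝ)..2, f (t - s) := by
      have := intervalIntegral.integral_sub (hint 1 t) (hint f t)
      norm_num at this ⊢
      exact this
    have ib : ∫ s in (1 : ℝ)..2, (1 + f) (t - s) = 1 + ∫ s in (1 : ℝ)..2, f (t - s) := by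
      have := intervalIntegral.integral_add (hint 1 t) (hint f t)
      norm_num at this ⊢
      exact this
    rw [ia] at a
    rw [ib] at b
    simp only [map_add, map_sub, transfer_one, BoundedContinuousFunction.coe_sub,
      BoundedContinuousFunction.coe_add, BoundedContinuousFunction.coe_one, Pi.sub_apply,
      Pi.add_apply, Pi.one_apply] at a b
    have c : transfer f t ≤ 1 :=
      (abs_le.1 (abs_halfLine_le (fun s => hf1 s) t 2)).2
    linarith [a.1, b.2]
  set A : (ℝ →ᵇ ℝ) →L[ℝ] (ℝ →ᵇ ℝ) := (1 / 2 : ℝ) • (1 - transfer)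
  have hε1 : ε ≤ 1 := by
    have := (h 1 (fun t => by simp) 0).1
    simpa [transfer_one, show (2 : ℝ) - 1 = 1 by norm_num] using this
  have hA : ‖A * A‖ ≤ 1 - ε / 2 := by
    refine ContinuousLinearMap.opNorm_le_of_unit_norm (by linarith) fun f hf => ?_
    refine (BoundedContinuousFunction.norm_le (by linarith)).2 fun t => ?_
    have e : (A * A) f t = 1 / 4 * (f t - (2 * transfer f t - transfer (transfer f) t)) := by
      simp [A]
      ring
    have k1 := key f hf.le t
    have k2 := key (-f) (by rw [norm_neg, hf]) t
    simp only [map_neg, BoundedContinuousFunction.coe_neg, Pi.neg_apply] at k2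
    have k3 := abs_le.1 ((abs_apply_le f t).trans hf.le)
    rw [e, Real.norm_eq_abs, abs_le]
    constructor <;> linarith [k3.1, k3.2]
  have hlt : ‖A * A‖ < 1 := by linarith
  have hu : IsUnit (1 - A * A) :=
    isUnit_one_sub_of_norm_lt_one (R := (ℝ →ᵇ ℝ) →L[ℝ] (ℝ →ᵇ ℝ)) hlt
  obtain ⟨V, hV⟩ := (isUnit_one_sub_of_isUnit_one_sub_mul_self
    (R := (ℝ →ᵇ ℝ) →L[ℝ] (ℝ →ᵇ ℝ)) hu).exists_right_inv
  refine ⟨(1 / 2 : ℝ) • V G, ?_⟩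
  ext t
  have h1 := DFunLike.congr_fun (DFunLike.congr_fun hV G) t
  simp [A] at h1 ⊢
  linarith

/-- The density `φ` for which `halfLine φ t (1 - x) + halfLine φ t (1 + x)` has the boundary
values `g` at `x = 1`. -/
theorem exists_density {g : ℝ → ℝ} (hg : Continuous g) {B : ℝ} (hB : ∀ t, |g t| ≤ B) :
    ∃ φ : ℝ → ℝ, Continuous φ ∧ (∃ C, ∀ t, |φ t| ≤ C) ∧ ∀ t, φ t + halfLine φ t 2 = g t := by
  obtain ⟨φ, hφ⟩ := exists_add_transfer_eq (BoundedContinuousFunction.ofNormedAddCommGroup g hg B hB)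
  exact ⟨φ, φ.continuous, ⟨‖φ‖, abs_apply_le φ⟩, fun t => DFunLike.congr_fun hφ t⟩

end SteadyHeat

namespace SteadyHeat

open Filter Topology

/-! ### Curves in spaces of continuous functions -/

open Classical in
/-- The restriction of `f` to `K` as a bundled continuous function (`0` if it is not continuous). -/
noncomputable def restr (K : Set ℝ) (f : ℝ → ℝ) : C(K, ℝ) :=
  if h : ContinuousOn f K then ⟨K.domRestrict f, h.domRestrict⟩ else 0

theorem restr_apply {K : Set ℝ} {f : ℝ → ℝ} (h : ContinuousOn f K) (x : K) :
    restr K f x = f x := by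
  simp only [restr, h, dif_pos]
  rfl

theorem continuousOn_restr {K I : Set ℝ} {F : ℝ → ℝ → ℝ}
    (hF : ContinuousOn (fun p : ℝ × ℝ => F p.1 p.2) (I ×ˢ K)) :
    ContinuousOn (fun t => restr K (F t)) I := by
  rw [continuousOn_iff_continuous_domRestrict]
  refine ContinuousMap.continuous_of_continuous_uncurry _ ?_
  have hs : ∀ t ∈ I, ContinuousOn (F t) K := fun t ht =>
    hF.comp (f := fun x : ℝ => (t, x)) (by fun_prop) fun x hx => ⟨ht, hx⟩
  have : (Function.uncurry fun (t : I) (x : K) => I.domRestrict (fun t => restr K (F t)) t x) =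
      fun q : I × K => F q.1 q.2 := by
    ext ⟨t, x⟩
    exact restr_apply (hs t t.2) x
  rw [this]
  exact hF.comp_continuous (f := fun q : I × K => ((q.1 : ℝ), (q.2 : ℝ))) (by fun_prop)
    fun q => ⟨q.1.2, q.2.2⟩

/-- The mean value inequality for `F r x - r F' t x` bounds the remainder uniformly in `x`, because
`F'` is continuous in time for the sup norm. -/
theorem hasDerivAt_restr {K I : Set ℝ} [CompactSpace K] (hI : IsOpen I) {F F' : ℝ → ℝ → ℝ}
    (hF : ContinuousOn (fun p : ℝ × ℝ => F p.1 p.2) (I ×ˢ K))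
    (hF' : ContinuousOn (fun p : ℝ × ℝ => F' p.1 p.2) (I ×ˢ K))
    (hd : ∀ t ∈ I, ∀ x ∈ K, HasDerivAt (fun t => F t x) (F' t x) t) {t : ℝ} (ht : t ∈ I) :
    HasDerivAt (fun t => restr K (F t)) (restr K (F' t)) t := by
  have hs : ∀ {G : ℝ → ℝ → ℝ}, ContinuousOn (fun p : ℝ × ℝ => G p.1 p.2) (I ×ˢ K) →
      ∀ t ∈ I, ContinuousOn (G t) K := fun hG t ht =>
    hG.comp (f := fun x : ℝ => (t, x)) (by fun_prop) fun x hx => ⟨ht, hx⟩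
  have hc : ContinuousAt (fun t => restr K (F' t)) t :=
    (continuousOn_restr hF').continuousAt (hI.mem_nhds ht)
  rw [hasDerivAt_iff_isLittleO, Asymptotics.isLittleO_iff]
  intro ε hε
  have h1 : ∀ᶠ s in 𝓝 t, s ∈ I ∧ ‖restr K (F' s) - restr K (F' t)‖ ≤ ε := by
    refine (hI.eventually_mem ht).and ?_
    filter_upwards [Metric.continuousAt_iff'.1 hc ε hε] with s hs'
    rw [← dist_eq_norm]; exact hs'.le
  obtain ⟨δ, hδ, hball⟩ := Metric.eventually_nhds_iff_ball.1 h1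
  filter_upwards [Metric.ball_mem_nhds t hδ] with s hsδ
  refine (ContinuousMap.norm_le _ (by positivity)).2 fun x => ?_
  have hsub : Metric.ball t δ ⊆ I := fun r hr => (hball r hr).1
  have h2 := Convex.norm_image_sub_le_of_norm_hasDerivWithin_le (s := Metric.ball t δ)
    (f := fun r => F r x - r * F' t x) (f' := fun r => F' r x - F' t x) (C := ε) (x := t) (y := s)
    (fun r hr => ?_) (fun r hr => ?_) (convex_ball t δ) (Metric.mem_ball_self hδ) hsδ
  · simp only [ContinuousMap.sub_apply, ContinuousMap.smul_apply, smul_eq_mul,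
      restr_apply (hs hF s (hsub hsδ)), restr_apply (hs hF t ht), restr_apply (hs hF' t ht)]
    refine le_trans (le_of_eq ?_) h2
    congr 1; ring
  · have h3 := (hd r (hsub hr) x x.2).sub ((hasDerivAt_id r).mul_const (F' t x))
    simp only [one_mul] at h3
    exact h3.hasDerivWithinAt
  · have h3 := (ContinuousMap.norm_coe_le_norm _ x).trans (hball r hr).2
    simpa [restr_apply (hs hF' r (hsub hr)), restr_apply (hs hF' t ht)] using h3

theorem contDiffOn_restr {K I : Set ℝ} [CompactSpace K] (hI : IsOpen I) {Ω : Set (ℝ × ℝ)}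
    (hΩ : IsOpen Ω) (hIK : I ×ˢ K ⊆ Ω) (n : ℕ) {F : ℝ × ℝ → ℝ} (hF : ContDiffOn ℝ n F Ω) :
    ContDiffOn ℝ n (fun t => restr K fun x => F (t, x)) I := by
  induction n generalizing F with
  | zero =>
    exact contDiffOn_zero.2 (continuousOn_restr (F := fun t x => F (t, x))
      (hF.continuousOn.mono hIK))
  | succ n ih =>
    push_cast at hF
    have hd := (contDiffOn_succ_iff_fderiv_of_isOpen hΩ).1 hF
    have hF' : ContDiffOn ℝ n (fun p => fderiv ℝ F p (1, 0)) Ω := hd.2.2.clm_apply contDiffOn_const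
    have key : ∀ t ∈ I, HasDerivAt (fun t => restr K fun x => F (t, x))
        (restr K fun x => fderiv ℝ F (t, x) (1, 0)) t := by
      refine fun t ht => hasDerivAt_restr hI (F := fun t x => F (t, x))
        (F' := fun t x => fderiv ℝ F (t, x) (1, 0)) (hF.continuousOn.mono hIK)
        (hF'.continuousOn.mono hIK) (fun t ht x hx => ?_) ht
      have h1 := (hd.1.differentiableAt (hΩ.mem_nhds
        (hIK (show (t, x) ∈ I ×ˢ K from ⟨ht, hx⟩)))).hasFDerivAt
      exact h1.comp_hasDerivAt t ((hasDerivAt_id t).prodMk (hasDerivAt_const t x))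
    push_cast
    refine (contDiffOn_succ_iff_deriv_of_isOpen hI).2 ⟨fun t ht =>
      (key t ht).differentiableAt.differentiableWithinAt,
      fun h => absurd h (WithTop.natCast_ne_top n), ?_⟩
    exact (ih hF').congr fun t ht => (key t ht).deriv

/-! ### Regularity away from `x = 1` -/

/-- The partial derivative in the second variable. -/
noncomputable def partialSnd (F : ℝ × ℝ → ℝ) (p : ℝ × ℝ) : ℝ := fderiv ℝ F p (0, 1)

theorem contDiffOn_partialSnd {Ω : Set (ℝ × ℝ)} (hΩ : IsOpen Ω) {F : ℝ × ℝ → ℝ}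
    (hF : ContDiffOn ℝ (⊤ : ℕ∞) F Ω) : ContDiffOn ℝ (⊤ : ℕ∞) (partialSnd F) Ω :=
  (((contDiffOn_infty_iff_fderiv_of_isOpen hΩ).1 hF).2).clm_apply contDiffOn_const

theorem hasDerivAt_partialSnd {Ω : Set (ℝ × ℝ)} (hΩ : IsOpen Ω) {F : ℝ × ℝ → ℝ}
    (hF : ContDiffOn ℝ (⊤ : ℕ∞) F Ω) {t x : ℝ} (h : (t, x) ∈ Ω) :
    HasDerivAt (fun x => F (t, x)) (partialSnd F (t, x)) x := by
  have h1 := ((hF.differentiableOn (by simp)).differentiableAt (hΩ.mem_nhds h)).hasFDerivAt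
  exact h1.comp_hasDerivAt x ((hasDerivAt_const x t).prodMk (hasDerivAt_id x))

theorem iterate_partialSnd {Ω : Set (ℝ × ℝ)} (hΩ : IsOpen Ω) {F : ℝ × ℝ → ℝ}
    (hF : ContDiffOn ℝ (⊤ : ℕ∞) F Ω) {t : ℝ} {K : Set ℝ} (hK : UniqueDiffOn ℝ K)
    (h : ∀ x ∈ K, (t, x) ∈ Ω) (j : ℕ) :
    ContDiffOn ℝ (⊤ : ℕ∞) (partialSnd^[j] F) Ω ∧
      ∀ x ∈ K, iteratedDerivWithin j (fun x => F (t, x)) K x = (partialSnd^[j] F) (t, x) := by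
  induction j with
  | zero => exact ⟨hF, fun x _ => by simp⟩
  | succ j ih =>
    rw [Function.iterate_succ_apply']
    refine ⟨contDiffOn_partialSnd hΩ ih.1, fun x hx => ?_⟩
    rw [iteratedDerivWithin_succ, derivWithin_congr ih.2 (ih.2 x hx)]
    exact (hasDerivAt_partialSnd hΩ ih.1 (h x hx)).hasDerivWithinAt.derivWithin (hK x hx)

theorem memC1C2_of_contDiffOn {F : ℝ × ℝ → ℝ} {Ω : Set (ℝ × ℝ)} (hΩ : IsOpen Ω)
    (hF : ContDiffOn ℝ (⊤ : ℕ∞) F Ω) {r : ℝ} (hr : 0 < r) (h : univ ×ˢ Icc 0 r ⊆ Ω) :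
    MemC1C2 (fun t x => F (t, x)) r := by
  have hmem : ∀ t, ∀ x ∈ Icc 0 r, (t, x) ∈ Ω := fun t x hx => h ⟨mem_univ t, hx⟩
  refine ⟨fun t _ => ?_, fun j _ => ?_⟩
  · have := hF.comp (g := F) (f := fun x : ℝ => (t, x)) (s := Icc 0 r)
      (by fun_prop) fun x hx => hmem t x hx
    exact contDiffOn_infty.1 this 2
  · have hj := fun t => iterate_partialSnd hΩ hF (uniqueDiffOn_Icc hr) (hmem t) j
    refine ⟨fun t => restr (Icc 0 r) fun x => (partialSnd^[j] F) (t, x), ?_, fun t _ x => ?_⟩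
    · have := contDiffOn_restr isOpen_univ hΩ h 1 (contDiffOn_infty.1 (hj 0).1 1)
      exact this.mono (subset_univ _)
    · rw [(hj t).2 x x.2]
      refine restr_apply (f := fun x => (partialSnd^[j] F) (t, x)) ?_ x
      exact ((hj t).1.continuousOn).comp (f := fun x : ℝ => (t, x)) (by fun_prop) fun x hx =>
        hmem t x hx

end SteadyHeat

namespace SteadyHeat

open Filter Topology

/-! ### The solution -/

section HalfLine

variable {φ : ℝ → ℝ} {B : ℝ}

theorem admissible_halfPlane (hφ : Measurable φ) (hB : ∀ s, |φ s| ≤ B) :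
    Admissible φ {p | 0 < p.2} := by
  refine ⟨hφ, ⟨B, hB⟩, isOpen_lt continuous_const continuous_snd, fun p hp => ?_⟩
  refine ⟨{q | p.2 / 2 < q.2}, (isOpen_lt continuous_const continuous_snd).mem_nhds ?_, p.2 / 2,
    half_pos hp, fun q hq s _ => Or.inl ?_⟩
  · exact half_lt_self (show 0 < p.2 from hp)
  · exact (le_of_lt hq).trans (le_abs_self _)

theorem hasDerivAt_pot_snd (hφ : Measurable φ) (hB : ∀ s, |φ s| ≤ B) {m : ℕ} (hm : 3 ≤ m) (t : ℝ)
    {y : ℝ} (hy : 0 < y) :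
    HasDerivAt (fun y => pot m φ t y) (-(y / 2) * pot (m + 2) φ t y) y := by
  have h := ((admissible_halfPlane hφ hB).hasFDerivAt_pot hm (p := (t, y)) hy).comp_hasDerivAt y
    ((hasDerivAt_const y t).prodMk (hasDerivAt_id y))
  exact h.congr_deriv (by simp)

theorem hasDerivAt_pot_fst (hφ : Measurable φ) (hB : ∀ s, |φ s| ≤ B) {m : ℕ} (hm : 3 ≤ m) (t : ℝ)
    {y : ℝ} (hy : 0 < y) :
    HasDerivAt (fun t => pot m φ t y)
      (-(m / 2) * pot (m + 2) φ t y + y ^ 2 / 4 * pot (m + 4) φ t y) t := by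
  have h := ((admissible_halfPlane hφ hB).hasFDerivAt_pot hm (p := (t, y)) hy).comp_hasDerivAt t
    ((hasDerivAt_id t).prodMk (hasDerivAt_const t y))
  exact h.congr_deriv (by simp)

/-- The space derivative of `halfLine φ`. -/
noncomputable def halfLineX (φ : ℝ → ℝ) (t y : ℝ) : ℝ :=
  (pot 3 φ t y - y ^ 2 / 2 * pot 5 φ t y) / kapMass

/-- The time derivative, and second space derivative, of `halfLine φ`. -/
noncomputable def halfLineT (φ : ℝ → ℝ) (t y : ℝ) : ℝ :=
  (-(3 / 2) * y * pot 5 φ t y + y ^ 3 / 4 * pot 7 φ t y) / kapMass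

theorem hasDerivAt_halfLine_fst (hφ : Measurable φ) (hB : ∀ s, |φ s| ≤ B) (t : ℝ) {y : ℝ}
    (hy : 0 < y) : HasDerivAt (fun t => halfLine φ t y) (halfLineT φ t y) t := by
  simp only [halfLine_eq_pot φ _ hy]
  refine ((hasDerivAt_pot_fst hφ hB le_rfl t hy).const_mul _).congr_deriv ?_
  rw [halfLineT]
  push_cast
  ring

theorem hasDerivAt_halfLine_snd (hφ : Measurable φ) (hB : ∀ s, |φ s| ≤ B) (t : ℝ) {y : ℝ}
    (hy : 0 < y) : HasDerivAt (fun y => halfLine φ t y) (halfLineX φ t y) y := by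
  have h := ((hasDerivAt_id y).div_const kapMass).mul (hasDerivAt_pot_snd hφ hB le_rfl t hy)
  refine (h.congr_deriv ?_).congr_of_eventuallyEq ?_
  · simp only [halfLineX, id]; ring
  · filter_upwards [lt_mem_nhds hy] with z hz using halfLine_eq_pot φ t hz

theorem hasDerivAt_halfLineX (hφ : Measurable φ) (hB : ∀ s, |φ s| ≤ B) (t : ℝ) {y : ℝ}
    (hy : 0 < y) : HasDerivAt (fun y => halfLineX φ t y) (halfLineT φ t y) y := by
  have h := ((hasDerivAt_pot_snd hφ hB le_rfl t hy).sub ((((hasDerivAt_id y).pow 2).div_const 2).mul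
    (hasDerivAt_pot_snd hφ hB (m := 5) (by norm_num) t hy))).div_const kapMass
  refine h.congr_deriv ?_
  simp only [halfLineT, id]
  push_cast
  simp
  ring

theorem contDiffOn_halfLine (hφ : Measurable φ) (hB : ∀ s, |φ s| ≤ B) :
    ContDiffOn ℝ (⊤ : ℕ∞) (fun p : ℝ × ℝ => halfLine φ p.1 p.2) {p | 0 < p.2} := by
  have h := (admissible_halfPlane hφ hB).contDiffOn_pot (m := 3) le_rfl
  have h2 : ContDiffOn ℝ (⊤ : ℕ∞) (fun p : ℝ × ℝ => p.2 / kapMass * pot 3 φ p.1 p.2)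
    {p | 0 < p.2} := ContDiffOn.mul (by fun_prop) h
  exact h2.congr fun p hp => halfLine_eq_pot φ p.1 hp

theorem analyticAt_halfLine (hφ : Measurable φ) (hB : ∀ s, |φ s| ≤ B) (t : ℝ) {y : ℝ}
    (hy : 0 < y) : AnalyticAt ℝ (fun y => halfLine φ t y) y := by
  have h : AnalyticAt ℝ (fun y => y / kapMass * pot 3 φ t y) y :=
    (analyticAt_id.div_const).mul (analyticAt_pot hφ hB t hy.ne')
  refine h.congr ?_
  filter_upwards [lt_mem_nhds hy] with z hz using (halfLine_eq_pot φ t hz).symm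

end HalfLine

/-- The solution of the heat equation in `-1 < x < 1` with boundary density `φ`. -/
noncomputable def sol (φ : ℝ → ℝ) (t x : ℝ) : ℝ := halfLine φ t (1 - x) + halfLine φ t (1 + x)

/-- The solution of the damped heat equation with boundary density `φ`. -/
noncomputable def dampedSol (γ : ℝ) (φ : ℝ → ℝ) (t x : ℝ) : ℝ := Real.exp (-γ * t) * sol φ t x

variable {φ : ℝ → ℝ} {B : ℝ}

theorem sol_neg (φ : ℝ → ℝ) (t x : ℝ) : sol φ t (-x) = sol φ t x := by
  simp only [sol, sub_neg_eq_add, ← sub_eq_add_neg]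
  exact add_comm _ _

theorem sol_one (φ : ℝ → ℝ) (t : ℝ) : sol φ t 1 = φ t + halfLine φ t 2 := by
  rw [sol, sub_self, halfLine_zero]; norm_num

theorem abs_sol_le (hB : ∀ s, |φ s| ≤ B) (t x : ℝ) : |sol φ t x| ≤ 2 * B := by
  have h1 := abs_halfLine_le hB t (1 - x)
  have h2 := abs_halfLine_le hB t (1 + x)
  exact (abs_add_le _ _).trans (by linarith)

theorem continuous_sol (hφ : Continuous φ) (hB : ∀ s, |φ s| ≤ B) :
    Continuous fun p : ℝ × ℝ => sol φ p.1 p.2 := by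
  have h := continuous_halfLine hφ hB
  exact (h.comp (by fun_prop : Continuous fun p : ℝ × ℝ => (p.1, 1 - p.2))).add
    (h.comp (by fun_prop : Continuous fun p : ℝ × ℝ => (p.1, 1 + p.2)))

theorem continuous_dampedSol (γ : ℝ) (hφ : Continuous φ) (hB : ∀ s, |φ s| ≤ B) :
    Continuous fun p : ℝ × ℝ => dampedSol γ φ p.1 p.2 := by
  have := continuous_sol hφ hB
  unfold dampedSol
  fun_prop

theorem contDiffOn_dampedSol (γ : ℝ) (hφ : Measurable φ) (hB : ∀ s, |φ s| ≤ B) :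
    ContDiffOn ℝ (⊤ : ℕ∞) (fun p : ℝ × ℝ => dampedSol γ φ p.1 p.2) (univ ×ˢ Ioo (-1) 1) := by
  have h := contDiffOn_halfLine hφ hB
  have h1 := h.comp (g := fun p : ℝ × ℝ => halfLine φ p.1 p.2) (f := fun p : ℝ × ℝ => (p.1, 1 - p.2))
    (s := univ ×ˢ Ioo (-1) 1) (by fun_prop) fun p hp => sub_pos.2 hp.2.2
  have h2 := h.comp (g := fun p : ℝ × ℝ => halfLine φ p.1 p.2) (f := fun p : ℝ × ℝ => (p.1, 1 + p.2))
    (s := univ ×ˢ Ioo (-1) 1) (by fun_prop) fun p hp => by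
      have := hp.2.1
      change 0 < 1 + p.2
      linarith
  have h3 : ContDiffOn ℝ (⊤ : ℕ∞) (fun p : ℝ × ℝ => Real.exp (-γ * p.1)) (univ ×ˢ Ioo (-1) 1) := by
    fun_prop
  exact h3.mul (h1.add h2)

theorem hasDerivAt_sol_fst (hφ : Measurable φ) (hB : ∀ s, |φ s| ≤ B) (t : ℝ) {x : ℝ}
    (hx : x ∈ Ioo (-1 : ℝ) 1) :
    HasDerivAt (fun t => sol φ t x) (halfLineT φ t (1 - x) + halfLineT φ t (1 + x)) t :=
  (hasDerivAt_halfLine_fst hφ hB t (by linarith [hx.2])).add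
    (hasDerivAt_halfLine_fst hφ hB t (by linarith [hx.1]))

theorem hasDerivAt_sol_snd (hφ : Measurable φ) (hB : ∀ s, |φ s| ≤ B) (t : ℝ) {x : ℝ}
    (hx : x ∈ Ioo (-1 : ℝ) 1) :
    HasDerivAt (fun x => sol φ t x) (-halfLineX φ t (1 - x) + halfLineX φ t (1 + x)) x :=
  ((hasDerivAt_halfLine_snd hφ hB t (by linarith [hx.2])).comp_const_sub 1 x).add
    ((hasDerivAt_halfLine_snd hφ hB t (by linarith [hx.1])).comp_const_add 1 x)

theorem hasDerivAt_sol_snd_snd (hφ : Measurable φ) (hB : ∀ s, |φ s| ≤ B) (t : ℝ) {x : ℝ}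
    (hx : x ∈ Ioo (-1 : ℝ) 1) :
    HasDerivAt (fun x => -halfLineX φ t (1 - x) + halfLineX φ t (1 + x))
      (halfLineT φ t (1 - x) + halfLineT φ t (1 + x)) x := by
  have h := ((hasDerivAt_halfLineX hφ hB t (by linarith [hx.2])).comp_const_sub 1 x).neg.add
    ((hasDerivAt_halfLineX hφ hB t (by linarith [hx.1])).comp_const_add 1 x)
  exact h.congr_deriv (by ring)

theorem analyticAt_dampedSol (γ : ℝ) (hφ : Measurable φ) (hB : ∀ s, |φ s| ≤ B) (t : ℝ) {x : ℝ}
    (hx : x ∈ Ioo (-1 : ℝ) 1) : AnalyticAt ℝ (dampedSol γ φ t) x := by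
  have h1 : AnalyticAt ℝ (fun x => halfLine φ t (1 - x)) x :=
    (analyticAt_halfLine hφ hB t (y := 1 - x) (by linarith [hx.2])).fun_comp
      (f := fun x : ℝ => 1 - x) (by fun_prop)
  have h2 : AnalyticAt ℝ (fun x => halfLine φ t (1 + x)) x :=
    (analyticAt_halfLine hφ hB t (y := 1 + x) (by linarith [hx.1])).fun_comp
      (f := fun x : ℝ => 1 + x) (by fun_prop)
  exact analyticAt_const.mul (h1.add h2)

theorem dampedSol_mem_spaceA (γ : ℝ) (hφ : Continuous φ) (hB : ∀ s, |φ s| ≤ B) (t : ℝ) :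
    dampedSol γ φ t ∈ spaceA := by
  have hc : Continuous (dampedSol γ φ t) :=
    (continuous_dampedSol γ hφ hB).comp (Continuous.prodMk_right t)
  have ha := fun {x : ℝ} => analyticAt_dampedSol (x := x) γ hφ.measurable hB t
  refine ⟨?_, fun x hx => ?_, fun k => ?_⟩
  · refine MemLp.of_bound hc.aestronglyMeasurable (Real.exp (-γ * t) * (2 * B))
      (Eventually.of_forall fun x => ?_)
    rw [dampedSol, norm_mul, Real.norm_of_nonneg (Real.exp_pos _).le]
    exact mul_le_mul_of_nonneg_left (abs_sol_le hB t x) (Real.exp_pos _).le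
  · exact (ha ⟨by linarith [hx.1], hx.2⟩).analyticWithinAt
  · have h0 : (0 : ℝ) ∈ Ico (0 : ℝ) 1 := by simp
    rw [iteratedDerivWithin_eq_iteratedDeriv (uniqueDiffOn_Ico 0 1)
      (ha (by simp)).contDiffAt h0]
    -- The function is even, so an odd derivative at `0` equals its own negative.
    have h := iteratedDeriv_comp_neg (2 * k + 1) (dampedSol γ φ t) 0
    have e : (fun x => dampedSol γ φ t (-x)) = dampedSol γ φ t := by
      ext x; simp only [dampedSol, sol_neg]
    rw [e, neg_zero, Odd.neg_one_pow (by simp), smul_eq_mul] at h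
    linarith

theorem hasL2Bound_dampedSol (γ : ℝ) (hB : ∀ s, |φ s| ≤ B) : HasL2Bound γ (dampedSol γ φ) := by
  have hB0 : 0 ≤ B := (abs_nonneg _).trans (hB 0)
  refine ⟨2 * B + 1, by positivity, fun t _ => ?_⟩
  have h := eLpNorm_le_of_ae_bound (p := 2) (μ := volume.restrict (Ioo (0 : ℝ) 1))
    (f := dampedSol γ φ t) (C := Real.exp (-γ * t) * (2 * B)) (Eventually.of_forall fun x => by
      rw [dampedSol, norm_mul, Real.norm_of_nonneg (Real.exp_pos _).le]
      exact mul_le_mul_of_nonneg_left (abs_sol_le hB t x) (Real.exp_pos _).le)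
  refine h.trans_lt ?_
  have he := Real.exp_pos (-γ * t)
  simp only [Measure.restrict_apply_univ, Real.volume_Ioo, sub_zero, ENNReal.ofReal_one,
    ENNReal.one_rpow, one_mul]
  exact (ENNReal.ofReal_lt_ofReal_iff (by positivity)).2 (by nlinarith)

theorem isClassicalSolution_dampedSol {γ : ℝ} {u : ℝ → ℝ} (hφ : Continuous φ)
    (hB : ∀ s, |φ s| ≤ B) (hu : ∀ t ≤ 0, φ t + halfLine φ t 2 = Real.exp (γ * t) * u t) :
    IsClassicalSolution γ u (dampedSol γ φ) where
  continuousOn := (continuous_dampedSol γ hφ hB).continuousOn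
  memC1C2 r hr hr1 := by
    refine memC1C2_of_contDiffOn (F := fun p => dampedSol γ φ p.1 p.2)
      (isOpen_univ.prod isOpen_Ioo) (contDiffOn_dampedSol γ hφ.measurable hB) hr ?_
    exact prod_mono_right fun x hx => ⟨by linarith [hx.1], by linarith [hx.2]⟩
  heat t ht x hx := by
    have hmem : ∀ y ∈ Ico (0 : ℝ) 1, y ∈ Ioo (-1 : ℝ) 1 := fun y hy => ⟨by linarith [hy.1], hy.2⟩
    have hm := hφ.measurable
    have h1 : HasDerivAt (fun s => dampedSol γ φ s x) _ t :=
      (((hasDerivAt_id t).const_mul (-γ)).exp).mul (hasDerivAt_sol_fst hm hB t (hmem x hx))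
    have h2 : ∀ y ∈ Ico (0 : ℝ) 1, iteratedDerivWithin 1 (dampedSol γ φ t) (Ico 0 1) y =
        Real.exp (-γ * t) * (-halfLineX φ t (1 - y) + halfLineX φ t (1 + y)) := fun y hy => by
      rw [iteratedDerivWithin_one]
      exact ((hasDerivAt_sol_snd hm hB t (hmem y hy)).const_mul
        (Real.exp (-γ * t))).hasDerivWithinAt.derivWithin (uniqueDiffOn_Ico 0 1 y hy)
    rw [h1.hasDerivWithinAt.derivWithin (uniqueDiffOn_Iic 0 t ht), iteratedDerivWithin_succ,
      derivWithin_congr h2 (h2 x hx), (((hasDerivAt_sol_snd_snd hm hB t (hmem x hx)).const_mul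
        (Real.exp (-γ * t))).hasDerivWithinAt.derivWithin (uniqueDiffOn_Ico 0 1 x hx))]
    simp only [dampedSol, id]
    ring
  neumann t _ := by
    have := (dampedSol_mem_spaceA γ hφ hB t).2.2 0
    simpa [iteratedDerivWithin_one] using this
  dirichlet t ht := by
    rw [dampedSol, sol_one, hu t ht, ← mul_assoc, ← Real.exp_add]
    simp

end SteadyHeat

namespace SteadyHeat

open Filter Topology

/-! ### Completeness of the mixed Neumann-Dirichlet cosines -/

theorem integral_exp_mul_even {A : ℝ → ℝ} (hA : Continuous A) (heven : ∀ x, A (-x) = A x) (a : ℝ) :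
    ∫ x in (-1 : ℝ)..1, Complex.exp (a * x * Complex.I) * (A x : ℂ) =
      ((2 * ∫ x in (0 : ℝ)..1, A x * Real.cos (a * x) : ℝ) : ℂ) := by
  have hc : Continuous fun x : ℝ => Complex.exp (a * x * Complex.I) * (A x : ℂ) := by fun_prop
  have hc' : Continuous fun x : ℝ => Complex.exp (a * (-x : ℝ) * Complex.I) * (A (-x) : ℂ) := by
    fun_prop
  rw [← intervalIntegral.integral_add_adjacent_intervals (b := 0) (hc.intervalIntegrable _ _)
    (hc.intervalIntegrable _ _)]
  have h1 := intervalIntegral.integral_comp_neg (a := 0) (b := 1)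
    fun x : ℝ => Complex.exp (a * x * Complex.I) * (A x : ℂ)
  rw [neg_zero] at h1
  rw [← h1, ← intervalIntegral.integral_add (hc'.intervalIntegrable _ _)
    (hc.intervalIntegrable _ _), Complex.ofReal_mul, ← intervalIntegral.integral_ofReal,
    ← intervalIntegral.integral_const_mul]
  refine intervalIntegral.integral_congr fun x _ => ?_
  have h2 := Complex.two_cos (a * x)
  simp only [heven]
  push_cast
  rw [show (a * -x * Complex.I : ℂ) = -(a * x) * Complex.I by ring]
  rw [show (2 * ((A x : ℂ) * Complex.cos (a * x))) = A x * (2 * Complex.cos (a * x)) by ring, h2]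
  ring

/-- Extend `f` evenly to `[-1, 1]` and then antiperiodically, `G (x) = -G (x - 2)` on `[1, 3]`, to a
function of period `4`, continuous because `f 1 = 0`. Antiperiodicity kills its even Fourier
coefficients, and its odd ones are multiples of the given integrals. A continuous function whose
Fourier coefficients all vanish is zero. -/
theorem eq_zero_of_integral_cos_eq_zero {f : ℝ → ℝ} (hf : ContinuousOn f (Icc 0 1))
    (h1 : f 1 = 0)
    (h : ∀ n : ℕ, ∫ x in (0 : ℝ)..1, f x * Real.cos ((n + 1 / 2) * Real.pi * x) = 0) :
    ∀ x ∈ Icc (0 : ℝ) 1, f x = 0 := by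
  have : Fact ((0 : ℝ) < 4) := ⟨by norm_num⟩
  have h01 : (0 : ℝ) ≤ 1 := zero_le_one
  set g : ℝ → ℝ := IccExtend h01 ((Icc (0 : ℝ) 1).domRestrict f)
  have hg : Continuous g := hf.domRestrict.Icc_extend'
  have gf : ∀ x ∈ Icc (0 : ℝ) 1, g x = f x := fun x hx => IccExtend_of_mem _ _ hx
  have g1 : ∀ x, 1 ≤ x → g x = 0 := fun x hx => by
    simp only [g, IccExtend_of_right_le h01 _ hx]; exact h1
  set A : ℝ → ℝ := fun x => g |x|
  have hA : Continuous A := by fun_prop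
  have hAe : ∀ x, A (-x) = A x := fun x => by simp [A]
  have hodd : ∀ k : ℤ, Odd k → ∫ x in (0 : ℝ)..1, A x * Real.cos (Real.pi * k / 2 * x) = 0 := by
    have aux : ∀ n : ℕ, ∫ x in (0 : ℝ)..1, A x * Real.cos ((n + 1 / 2) * Real.pi * x) = 0 := by
      intro n
      refine Eq.trans ?_ (h n)
      refine intervalIntegral.integral_congr fun x hx => ?_
      rw [uIcc_of_le h01] at hx
      simp only [A, abs_of_nonneg hx.1, gf x hx]
    rintro k ⟨m, rfl⟩
    rcases le_or_gt 0 m with hm | hm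
    · lift m to ℕ using hm
      refine Eq.trans ?_ (aux m)
      refine intervalIntegral.integral_congr fun x _ => ?_
      congr 2; push_cast; ring
    · obtain ⟨n, hn⟩ := Int.eq_ofNat_of_zero_le (show 0 ≤ -m - 1 by omega)
      have hm' : (m : ℝ) = -n - 1 := by
        have : (m : ℤ) = -n - 1 := by omega
        exact_mod_cast this
      refine Eq.trans ?_ (aux n)
      refine intervalIntegral.integral_congr fun x _ => ?_
      rw [← Real.cos_neg]; congr 2; push_cast; rw [hm']; ring
  -- Since `A` vanishes for `|x| ≥ 1`, the two terms have essentially disjoint supports on the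
  -- period `[-1, 3]`.
  set G : ℝ → ℂ := fun x => ((A x - A (x - 2) : ℝ) : ℂ)
  have hG : Continuous G := by fun_prop
  have hGl : ∀ x ∈ Icc (-1 : ℝ) 1, G x = A x := fun x hx => by
    have : A (x - 2) = 0 := g1 _ (by rw [abs_sub_comm]; exact le_trans (by linarith [hx.2]) (le_abs_self _))
    simp [G, this]
  have hGr : ∀ x ∈ Icc (1 : ℝ) 3, G x = -A (x - 2) := fun x hx => by
    have : A x = 0 := g1 _ (hx.1.trans (le_abs_self _))
    simp [G, this]
  have hA1 : A (-1) = 0 := by rw [hAe]; exact g1 _ (by simp)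
  have hG13 : G (-1) = G (-1 + 4) := by
    rw [hGl (-1) (by norm_num), hGr (-1 + 4) (by norm_num), hA1]
    have : A (-1 + 4 - 2) = 0 := g1 _ (by norm_num)
    rw [this]; simp
  set Φ : C(AddCircle (4 : ℝ), ℂ) :=
    ⟨AddCircle.liftIco 4 (-1) G, AddCircle.liftIco_continuous hG13 hG.continuousOn⟩
  have hΦ : ∀ x ∈ Ico (-1 : ℝ) (-1 + 4), Φ (x : AddCircle (4 : ℝ)) = G x := fun x hx =>
    AddCircle.liftIco_coe_apply (f := G) hx
  have hcoeff : ∀ n : ℤ, fourierCoeff Φ n = 0 := by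
    intro n
    rw [fourierCoeff_eq_intervalIntegral _ n (-1)]
    have e1 : ∫ x in (-1 : ℝ)..(-1 + 4), (fourier (-n)) (x : AddCircle (4 : ℝ)) • Φ x =
        ∫ x in (-1 : ℝ)..(-1 + 4),
          Complex.exp ((-(Real.pi * n / 2) : ℝ) * x * Complex.I) * G x := by
      refine intervalIntegral.integral_congr_ae ?_
      have hne : ∀ᵐ x : ℝ, x ≠ (-1 + 4 : ℝ) := by simp [ae_iff]
      filter_upwards [hne] with x hx hx'
      rw [uIoc_of_le (by norm_num)] at hx'
      rw [hΦ x ⟨hx'.1.le, lt_of_le_of_ne hx'.2 hx⟩, fourier_coe_apply, smul_eq_mul]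
      congr 2
      push_cast; ring
    set a : ℝ := -(Real.pi * n / 2)
    have hci : Continuous fun x : ℝ => Complex.exp (a * x * Complex.I) * G x := by fun_prop
    have e2 : ∫ x in (-1 : ℝ)..1, Complex.exp (a * x * Complex.I) * G x =
        ∫ x in (-1 : ℝ)..1, Complex.exp (a * x * Complex.I) * (A x : ℂ) := by
      refine intervalIntegral.integral_congr fun x hx => ?_
      rw [uIcc_of_le (by norm_num)] at hx
      simp only [hGl x hx]
    have e3 : ∫ x in (1 : ℝ)..(-1 + 4), Complex.exp (a * x * Complex.I) * G x =
        -Complex.exp (a * 2 * Complex.I) *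
          ∫ x in (-1 : ℝ)..1, Complex.exp (a * x * Complex.I) * (A x : ℂ) := by
      have := intervalIntegral.integral_comp_sub_right (a := 1) (b := 3)
        (fun x : ℝ => Complex.exp (a * x * Complex.I) * (A x : ℂ)) 2
      norm_num at this ⊢
      rw [← this, ← intervalIntegral.integral_const_mul, ← intervalIntegral.integral_neg]
      refine intervalIntegral.integral_congr fun x hx => ?_
      rw [uIcc_of_le (by norm_num)] at hx
      simp only [hGr x hx]
      rw [show (a * x * Complex.I : ℂ) = a * 2 * Complex.I + a * (x - 2) * Complex.I by ring,
        Complex.exp_add]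
      ring
    rw [e1, ← intervalIntegral.integral_add_adjacent_intervals (b := 1)
      (hci.intervalIntegrable _ _) (hci.intervalIntegrable _ _), e2, e3,
      integral_exp_mul_even hA hAe]
    -- The total is `1 - exp (2 a I)` times the integral over `[-1, 1]`: the first factor vanishes
    -- for even `n`, the second for odd `n`.
    rcases Int.even_or_odd n with hn | hn
    · obtain ⟨k, rfl⟩ := hn
      have : Complex.exp (a * 2 * Complex.I) = 1 := by
        rw [Complex.exp_eq_one_iff]
        refine ⟨-k, ?_⟩
        simp only [a]; push_cast; ring
      rw [this]; simp
    · have : ∫ x in (0 : ℝ)..1, A x * Real.cos (a * x) = 0 := by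
        refine Eq.trans ?_ (hodd n hn)
        refine intervalIntegral.integral_congr fun x _ => ?_
        simp only [a]; rw [← Real.cos_neg]; congr 2; ring
      rw [this]; simp
  intro x hx
  have hsum : Summable (fourierCoeff Φ) := by
    rw [funext hcoeff]; exact summable_zero
  have hs := has_pointwise_sum_fourier_series_of_summable hsum (x : AddCircle (4 : ℝ))
  simp only [hcoeff, zero_smul] at hs
  have h0 := hs.unique hasSum_zero
  rw [hΦ x ⟨by linarith [hx.1], by linarith [hx.2]⟩, hGl x ⟨by linarith [hx.1], hx.2⟩] at h0
  have : A x = f x := by simp only [A, abs_of_nonneg hx.1, gf x hx]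
  rw [← this]; exact_mod_cast h0

end SteadyHeat

namespace SteadyHeat

open Filter Topology

/-! ### Uniqueness -/

/-- The primitive vanishing at `0`, as an operator on continuous functions on `[0, r]`. -/
noncomputable def primitive {r : ℝ} (hr : 0 ≤ r) : C(Icc (0 : ℝ) r, ℝ) →L[ℝ] C(Icc (0 : ℝ) r, ℝ) :=
  LinearMap.mkContinuous
    { toFun := fun f => ⟨fun x => ∫ z in (0 : ℝ)..x, IccExtend hr f z,
        (intervalIntegral.continuous_primitive (fun a b =>
          (f.continuous.Icc_extend' (h := hr)).intervalIntegrable a b) 0).comp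
          continuous_subtype_val⟩
      map_add' := fun f g => by
        ext x
        exact intervalIntegral.integral_add ((f.continuous.Icc_extend' (h := hr)).intervalIntegrable _ _)
          ((g.continuous.Icc_extend' (h := hr)).intervalIntegrable _ _)
      map_smul' := fun c f => by
        ext x
        exact intervalIntegral.integral_const_mul c _ }
    r fun f => by
      refine (ContinuousMap.norm_le _ (by positivity)).2 fun x => ?_
      have h := intervalIntegral.norm_integral_le_of_norm_le_const (a := 0) (b := x)
        (f := IccExtend hr f) (C := ‖f‖) fun z _ => ContinuousMap.norm_coe_le_norm f _
      refine h.trans ?_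
      rw [sub_zero, abs_of_nonneg x.2.1, mul_comm]
      exact mul_le_mul_of_nonneg_right x.2.2 (norm_nonneg f)

theorem primitive_apply {r : ℝ} (hr : 0 ≤ r) (f : C(Icc (0 : ℝ) r, ℝ)) (x : Icc (0 : ℝ) r) :
    primitive hr f x = ∫ z in (0 : ℝ)..x, IccExtend hr f z := rfl

theorem eq_of_eqOn_Ico {r : ℝ} (hr : 0 < r) {f g : C(Icc (0 : ℝ) r, ℝ)}
    (h : ∀ x : Icc (0 : ℝ) r, (x : ℝ) < r → f x = g x) : f = g := by
  have h1 : EqOn (IccExtend hr.le f) (IccExtend hr.le g) (Ico 0 r) := fun x hx => by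
    rw [IccExtend_of_mem _ _ ⟨hx.1, hx.2.le⟩, IccExtend_of_mem _ _ ⟨hx.1, hx.2.le⟩]
    exact h _ hx.2
  have h2 := h1.closure (f.continuous.Icc_extend' (h := hr.le)) (g.continuous.Icc_extend' (h := hr.le))
  rw [closure_Ico hr.ne] at h2
  ext x
  have := h2 x.2
  rwa [IccExtend_val, IccExtend_val] at this

theorem Ico_eventuallyEq_Icc {r x : ℝ} (hr1 : r ≤ 1) (hx : x < r) :
    Ico (0 : ℝ) 1 =ᶠ[𝓝 x] Icc (0 : ℝ) r := by
  filter_upwards [gt_mem_nhds hx] with y hy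
  exact propext ⟨fun h => ⟨h.1, hy.le⟩, fun h => ⟨h.1, hy.trans_le hr1⟩⟩

/-- Point evaluation identifies the derivative of the curve with the right side of the equation for
`x < r`, and continuity supplies `x = r`. The case `r = 1`, where no equation is assumed at `x = 1`,
is needed for the regularity criterion. -/
theorem MemC1C2.exists_curves {γ r : ℝ} {w : ℝ → ℝ → ℝ} (h : MemC1C2 w r) (hr : 0 < r) (hr1 : r ≤ 1)
    (hheat : ∀ t ≤ 0, ∀ x ∈ Ico (0 : ℝ) 1, derivWithin (fun s => w s x) (Iic 0) t
      = iteratedDerivWithin 2 (w t) (Ico 0 1) x - γ * w t x) :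
    ∃ W₀ W₂ : ℝ → C(Icc (0 : ℝ) r, ℝ), ContDiffOn ℝ 1 W₀ (Iic 0) ∧ ContDiffOn ℝ 1 W₂ (Iic 0) ∧
      (∀ t ≤ 0, ∀ x : Icc (0 : ℝ) r, W₀ t x = w t x) ∧
      (∀ t ≤ 0, ∀ x : Icc (0 : ℝ) r, W₂ t x = iteratedDerivWithin 2 (w t) (Icc 0 r) x) ∧
      ∀ t ≤ 0, HasDerivWithinAt W₀ (W₂ t - γ • W₀ t) (Iic 0) t := by
  obtain ⟨W₀, hW₀, h₀⟩ := h.2 0 (by norm_num)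
  obtain ⟨W₂, hW₂, h₂⟩ := h.2 2 le_rfl
  simp only [iteratedDerivWithin_zero] at h₀
  refine ⟨W₀, W₂, hW₀, hW₂, h₀, h₂, fun t ht => ?_⟩
  have hd := ((hW₀.differentiableOn one_ne_zero) t ht).hasDerivWithinAt
  refine hd.congr_deriv (eq_of_eqOn_Ico hr fun x hx => ?_)
  have hx1 : (x : ℝ) ∈ Ico (0 : ℝ) 1 := ⟨x.2.1, hx.trans_le hr1⟩
  have h1 := (ContinuousMap.evalCLM ℝ x).hasFDerivAt.comp_hasDerivWithinAt t hd
  have h2 : HasDerivWithinAt (fun s => w s x) (derivWithin W₀ (Iic 0) t x) (Iic 0) t :=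
    h1.congr (fun s hs => (h₀ s hs x).symm) (h₀ t ht x).symm
  have h3 := hheat t ht x hx1
  rw [h2.derivWithin (uniqueDiffOn_Iic 0 t ht),
    iteratedDerivWithin, iteratedFDerivWithin_congr_set (Ico_eventuallyEq_Icc hr1 hx),
    ← iteratedDerivWithin] at h3
  rw [h3, ContinuousMap.sub_apply, ContinuousMap.smul_apply, h₂ t ht, h₀ t ht, smul_eq_mul]

/-- Two integrations by parts. The cosine vanishes at `r`, so `f' (r)` does not appear, which is
essential since nothing controls the normal derivative as `r → 1`. -/
theorem integral_iteratedDerivWithin_two_mul_cos {f : ℝ → ℝ} {r μ : ℝ} (hr : 0 < r)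
    (hf : ContDiffOn ℝ 2 f (Icc 0 r)) (h0 : derivWithin f (Icc 0 r) 0 = 0) (hμ : Real.cos μ = 0) :
    ∫ x in (0 : ℝ)..r, iteratedDerivWithin 2 f (Icc 0 r) x * Real.cos (μ / r * x) =
      μ / r * Real.sin μ * f r - (μ / r) ^ 2 * ∫ x in (0 : ℝ)..r, f x * Real.cos (μ / r * x) := by
  have hu := uniqueDiffOn_Icc hr
  set a := μ / r
  have har : a * r = μ := div_mul_cancel₀ μ hr.ne'
  set f₁ := derivWithin f (Icc 0 r)
  set f₂ := iteratedDerivWithin 2 f (Icc 0 r)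
  have hc₀ : ContinuousOn f (Icc 0 r) := hf.continuousOn
  have hd₁ : ContDiffOn ℝ 1 f₁ (Icc 0 r) := ((contDiffOn_succ_iff_derivWithin (n := 1) hu).1 hf).2.2
  have hc₁ : ContinuousOn f₁ (Icc 0 r) := hd₁.continuousOn
  have hc₂ : ContinuousOn f₂ (Icc 0 r) := hf.continuousOn_iteratedDerivWithin le_rfl hu
  have e₂ : ∀ x ∈ Icc 0 r, f₂ x = derivWithin f₁ (Icc 0 r) x := fun x hx => by
    simp only [f₂]
    rw [iteratedDerivWithin_succ]
    exact derivWithin_congr (fun y _ => by rw [iteratedDerivWithin_one])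
      (by rw [iteratedDerivWithin_one])
  have hderiv : ∀ x ∈ Ioo 0 r, HasDerivAt
      (fun x => f₁ x * Real.cos (a * x) + f x * (a * Real.sin (a * x)))
      (f₂ x * Real.cos (a * x) + a ^ 2 * (f x * Real.cos (a * x))) x := fun x hx => by
    have hx' := Ioo_subset_Icc_self hx
    have hn : Icc 0 r ∈ 𝓝 x := Icc_mem_nhds hx.1 hx.2
    have d₀ : HasDerivAt f (f₁ x) x :=
      ((hf.differentiableOn two_ne_zero) x hx').hasDerivWithinAt.hasDerivAt hn
    have d₁ : HasDerivAt f₁ (f₂ x) x := by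
      rw [e₂ x hx']
      exact ((hd₁.differentiableOn one_ne_zero) x hx').hasDerivWithinAt.hasDerivAt hn
    have l : HasDerivAt (fun x : ℝ => a * x) a x := by simpa using (hasDerivAt_id x).const_mul a
    have := (d₁.mul l.cos).add (d₀.mul (l.sin.const_mul a))
    exact this.congr_deriv (by ring)
  have ccos : Continuous fun x : ℝ => Real.cos (a * x) := by fun_prop
  have csin : Continuous fun x : ℝ => a * Real.sin (a * x) := by fun_prop
  have i₂ : IntervalIntegrable (fun x => f₂ x * Real.cos (a * x)) volume 0 r :=
    (ContinuousOn.mul (by rwa [uIcc_of_le hr.le]) ccos.continuousOn).intervalIntegrable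
  have i₀ : IntervalIntegrable (fun x => f x * Real.cos (a * x)) volume 0 r :=
    (ContinuousOn.mul (by rwa [uIcc_of_le hr.le]) ccos.continuousOn).intervalIntegrable
  have key := intervalIntegral.integral_eq_sub_of_hasDerivAt_of_le hr.le
    (f := fun x => f₁ x * Real.cos (a * x) + f x * (a * Real.sin (a * x)))
    ((hc₁.mul ccos.continuousOn).add (hc₀.mul csin.continuousOn)) hderiv (i₂.add (i₀.const_mul _))
  rw [intervalIntegral.integral_add i₂ (i₀.const_mul _), intervalIntegral.integral_const_mul] at key
  simp only [har, hμ, h0, mul_zero, zero_mul, Real.sin_zero, zero_add, sub_zero] at key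
  linarith

theorem IsClassicalSolution.coeff_sub_of_lt_one {γ : ℝ} {u : ℝ → ℝ} {w : ℝ → ℝ → ℝ}
    (h : IsClassicalSolution γ u w) {r : ℝ} (hr : 0 < r) (hr1 : r < 1) {μ : ℝ} (hμ : Real.cos μ = 0)
    {T t : ℝ} (hT : T ≤ t) (ht : t ≤ 0) :
    (Real.exp ((γ + (μ / r) ^ 2) * t) * ∫ x in (0 : ℝ)..r, w t x * Real.cos (μ / r * x)) -
      (Real.exp ((γ + (μ / r) ^ 2) * T) * ∫ x in (0 : ℝ)..r, w T x * Real.cos (μ / r * x)) =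
    ∫ s in T..t, Real.exp ((γ + (μ / r) ^ 2) * s) * (μ / r * Real.sin μ * w s r) := by
  have hm := h.memC1C2 r hr hr1
  obtain ⟨W₀, W₂, hW₀, -, h₀, h₂, hd⟩ := hm.exists_curves hr hr1.le h.heat
  set a := μ / r
  set l := γ + a ^ 2
  set ψ : C(Icc (0 : ℝ) r, ℝ) := ⟨fun x => Real.cos (a * x), by fun_prop⟩
  -- `L` is integration against the cosine, as a continuous functional, so that it can be composed
  -- with the differentiable curve `W₀`.
  set L : C(Icc (0 : ℝ) r, ℝ) →L[ℝ] ℝ := (ContinuousMap.evalCLM ℝ (⟨r, hr.le, le_rfl⟩ : Icc (0 : ℝ) r)).comp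
    ((primitive hr.le).comp (ContinuousLinearMap.mul ℝ C(Icc (0 : ℝ) r, ℝ) ψ))
  have hL : ∀ (f : C(Icc (0 : ℝ) r, ℝ)) (g : ℝ → ℝ), (∀ x, f x = g x) →
      L f = ∫ x in (0 : ℝ)..r, g x * Real.cos (a * x) := by
    intro f g hfg
    change ∫ z in (0 : ℝ)..r, IccExtend hr.le (ψ * f) z = _
    refine intervalIntegral.integral_congr fun x hx => ?_
    rw [uIcc_of_le hr.le] at hx
    simp only [IccExtend_of_mem hr.le _ hx, ContinuousMap.mul_apply, hfg]
    exact mul_comm _ _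
  have hD : ∀ s ≤ 0, HasDerivWithinAt (fun s => Real.exp (l * s) * L (W₀ s))
      (Real.exp (l * s) * (a * Real.sin μ * w s r)) (Iic 0) s := by
    intro s hs
    have e0 : derivWithin (w s) (Icc 0 r) 0 = 0 := by
      rw [← derivWithin_congr_set (Ico_eventuallyEq_Icc hr1.le hr)]
      exact h.neumann s hs
    have h1 := L.hasFDerivAt.comp_hasDerivWithinAt s (hd s hs)
    have h2 : HasDerivWithinAt (fun s : ℝ => Real.exp (l * s)) (Real.exp (l * s) * l) (Iic 0) s := by
      simpa using (((hasDerivAt_id s).const_mul l).exp).hasDerivWithinAt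
    refine (h2.mul h1).congr_deriv ?_
    rw [map_sub, map_smul, hL (W₂ s) _ (h₂ s hs), hL (W₀ s) _ (h₀ s hs),
      integral_iteratedDerivWithin_two_mul_cos hr (hm.1 s hs) e0 hμ, smul_eq_mul]
    simp only [Function.comp_apply, hL (W₀ s) _ (h₀ s hs), l, a]
    ring
  rw [← hL (W₀ t) _ (h₀ t ht), ← hL (W₀ T) _ (h₀ T (hT.trans ht))]
  symm
  refine intervalIntegral.integral_eq_sub_of_hasDerivAt_of_le hT
    (f := fun s => Real.exp (l * s) * L (W₀ s))
    (fun s hs => (hD s (hs.2.trans ht)).continuousWithinAt.mono fun x hx => hx.2.trans ht)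
    (fun s hs => (hD s (hs.2.le.trans ht)).hasDerivAt (Iic_mem_nhds (hs.2.trans_le ht))) ?_
  refine ContinuousOn.intervalIntegrable ?_
  rw [uIcc_of_le hT]
  have hw : ContinuousOn (fun s => w s r) (Icc T t) :=
    h.continuousOn.comp (f := fun s : ℝ => (s, r)) (by fun_prop)
      fun s hs => ⟨hs.2.trans ht, hr.le, hr1.le⟩
  fun_prop

/-- Let `r → 1` in the identity on `[0, r]`: both sides are continuous in `r`, as `w` is continuous
up to `x = 1`. -/
theorem IsClassicalSolution.coeff_sub {γ : ℝ} {u : ℝ → ℝ} {w : ℝ → ℝ → ℝ}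
    (h : IsClassicalSolution γ u w) {μ : ℝ} (hμ : Real.cos μ = 0)
    {T t : ℝ} (hT : T ≤ t) (ht : t ≤ 0) :
    (Real.exp ((γ + μ ^ 2) * t) * ∫ x in (0 : ℝ)..1, w t x * Real.cos (μ * x)) -
      (Real.exp ((γ + μ ^ 2) * T) * ∫ x in (0 : ℝ)..1, w T x * Real.cos (μ * x)) =
    ∫ s in T..t, Real.exp ((γ + μ ^ 2) * s) * (μ * Real.sin μ * u s) := by
  set W : ℝ → ℝ → ℝ := fun s x => w (min s 0) (projIcc 0 1 zero_le_one x)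
  have hW : Continuous fun p : ℝ × ℝ => W p.1 p.2 := by
    refine h.continuousOn.comp_continuous
      (f := fun p : ℝ × ℝ => (min p.1 0, ((projIcc (0 : ℝ) 1 zero_le_one p.2 : Icc (0 : ℝ) 1) : ℝ)))
      ?_ fun p => ⟨mem_Iic.2 (min_le_right _ _), (projIcc (0 : ℝ) 1 zero_le_one p.2).2⟩
    have := continuous_projIcc (a := (0 : ℝ)) (b := 1) (h := zero_le_one)
    fun_prop
  have Ww : ∀ s ≤ 0, ∀ x ∈ Icc (0 : ℝ) 1, W s x = w s x := fun s hs x hx => by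
    simp only [W, min_eq_left hs, projIcc_of_mem _ hx]
  -- The cutoff at `1/2` only keeps `a` continuous on the whole line; the identity is used for `1/2
  -- < r < 1`.
  set a : ℝ → ℝ := fun r => μ / max r (1 / 2)
  have ha : Continuous a :=
    continuous_const.div (by fun_prop) fun r => (lt_max_of_lt_right (by norm_num)).ne'
  have ha' : ∀ r ∈ Ioo (1 / 2 : ℝ) 1, a r = μ / r := fun r hr => by
    simp only [a, max_eq_left hr.1.le]
  have hcoef : ∀ s, Continuous fun r => ∫ x in (0 : ℝ)..r, W s x * Real.cos (a r * x) := fun s =>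
    intervalIntegral.continuous_parametric_intervalIntegral_of_continuous
      (f := fun r x => W s x * Real.cos (a r * x)) (by
        have : Continuous fun p : ℝ × ℝ => W s p.2 :=
          hW.comp (by fun_prop : Continuous fun p : ℝ × ℝ => (s, p.2))
        fun_prop) continuous_id
  have hl : Continuous fun r =>
      (Real.exp ((γ + a r ^ 2) * t) * ∫ x in (0 : ℝ)..r, W t x * Real.cos (a r * x)) -
      (Real.exp ((γ + a r ^ 2) * T) * ∫ x in (0 : ℝ)..r, W T x * Real.cos (a r * x)) := by
    have h1 := hcoef t
    have h2 := hcoef T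
    fun_prop
  have hrr : Continuous fun r =>
      ∫ s in T..t, Real.exp ((γ + a r ^ 2) * s) * (a r * Real.sin μ * W s r) :=
    intervalIntegral.continuous_parametric_intervalIntegral_of_continuous
      (f := fun r s => Real.exp ((γ + a r ^ 2) * s) * (a r * Real.sin μ * W s r)) (by
        have : Continuous fun p : ℝ × ℝ => W p.2 p.1 := hW.comp continuous_swap
        fun_prop) continuous_const
  have hint : ∀ s ≤ 0, ∀ r ∈ Icc (0 : ℝ) 1, ∀ b : ℝ,
      ∫ x in (0 : ℝ)..r, W s x * Real.cos (b * x) = ∫ x in (0 : ℝ)..r, w s x * Real.cos (b * x) := by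
    intro s hs r hr b
    refine intervalIntegral.integral_congr fun x hx => ?_
    rw [uIcc_of_le hr.1] at hx
    simp only [Ww s hs x ⟨hx.1, hx.2.trans hr.2⟩]
  have heq : EqOn
      (fun r => (Real.exp ((γ + a r ^ 2) * t) * ∫ x in (0 : ℝ)..r, W t x * Real.cos (a r * x)) -
        (Real.exp ((γ + a r ^ 2) * T) * ∫ x in (0 : ℝ)..r, W T x * Real.cos (a r * x)))
      (fun r => ∫ s in T..t, Real.exp ((γ + a r ^ 2) * s) * (a r * Real.sin μ * W s r))
      (Ioo (1 / 2 : ℝ) 1) := fun r hr => by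
    have hr0 : 0 < r := lt_trans (by norm_num) hr.1
    have e := h.coeff_sub_of_lt_one hr0 hr.2 hμ hT ht
    rw [← ha' r hr, ← hint t ht r ⟨hr0.le, hr.2.le⟩, ← hint T (hT.trans ht) r ⟨hr0.le, hr.2.le⟩] at e
    refine e.trans (intervalIntegral.integral_congr fun s hs => ?_)
    rw [uIcc_of_le hT] at hs
    simp only [Ww s (hs.2.trans ht) r ⟨hr0.le, hr.2.le⟩]
  have h1 : (1 : ℝ) ∈ closure (Ioo (1 / 2 : ℝ) 1) := by
    rw [closure_Ioo (by norm_num)]; norm_num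
  have e := heq.closure hl hrr h1
  have a1 : a 1 = μ := by simp only [a]; norm_num
  simp only [a1] at e
  rw [hint t ht 1 (by simp), hint T (hT.trans ht) 1 (by simp)] at e
  refine e.trans (intervalIntegral.integral_congr fun s hs => ?_)
  rw [uIcc_of_le hT] at hs
  simp only [Ww s (hs.2.trans ht) 1 (by simp), h.dirichlet s (hs.2.trans ht)]

theorem abs_coeff_le {f : ℝ → ℝ} (hf : ContinuousOn f (Icc 0 1)) {C : ℝ} (hC : 0 ≤ C)
    (h : eLpNorm f 2 (volume.restrict (Ioo 0 1)) ≤ ENNReal.ofReal C) (μ : ℝ) :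
    |∫ x in (0 : ℝ)..1, f x * Real.cos (μ * x)| ≤ C := by
  have hprob : IsProbabilityMeasure (volume.restrict (Ioo (0 : ℝ) 1)) := ⟨by simp⟩
  have hm : AEStronglyMeasurable f (volume.restrict (Ioo 0 1)) :=
    (hf.mono Ioo_subset_Icc_self).aestronglyMeasurable measurableSet_Ioo
  have h1 := (eLpNorm_le_eLpNorm_of_exponent_le (p := 1) (q := 2) (by norm_num) hm).trans h
  rw [intervalIntegral.integral_of_le zero_le_one, integral_Ioc_eq_integral_Ioo]
  have h2 : ‖∫ x in Ioo (0 : ℝ) 1, f x * Real.cos (μ * x)‖ₑ ≤ ENNReal.ofReal C := by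
    refine (enorm_integral_le_lintegral_enorm _).trans (le_trans ?_ h1)
    rw [eLpNorm_one_eq_lintegral_enorm]
    refine lintegral_mono fun x => ?_
    rw [enorm_mul]
    refine mul_le_of_le_one_right (zero_le) ?_
    rw [← ofReal_norm, Real.norm_eq_abs, ENNReal.ofReal_le_one]
    exact Real.abs_cos_le_one _
  rw [← ofReal_norm, Real.norm_eq_abs] at h2
  exact (ENNReal.ofReal_le_ofReal_iff hC).1 h2

theorem IsClassicalSolution.eq_of_hasL2Bound {γ : ℝ} {u : ℝ → ℝ} {w w' : ℝ → ℝ → ℝ}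
    (h : IsClassicalSolution γ u w) (hb : HasL2Bound γ w) (h' : IsClassicalSolution γ u w')
    (hb' : HasL2Bound γ w') : ∀ t ≤ 0, ∀ x ∈ Icc (0 : ℝ) 1, w' t x = w t x := by
  intro t ht
  obtain ⟨C, hC, hw⟩ := hb
  obtain ⟨C', hC', hw'⟩ := hb'
  have hcont : ∀ {v : ℝ → ℝ → ℝ}, IsClassicalSolution γ u v → ∀ s ≤ 0, ContinuousOn (v s) (Icc 0 1) :=
    fun hv s hs => hv.continuousOn.comp (f := fun x : ℝ => (s, x)) (by fun_prop) fun x hx => ⟨hs, hx⟩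
  suffices H : ∀ x ∈ Icc (0 : ℝ) 1, w' t x - w t x = 0 from fun x hx => sub_eq_zero.1 (H x hx)
  refine eq_zero_of_integral_cos_eq_zero ((hcont h' t ht).sub (hcont h t ht))
    (by rw [h'.dirichlet t ht, h.dirichlet t ht, sub_self]) fun n => ?_
  set μ := ((n : ℝ) + 1 / 2) * Real.pi
  have hμ0 : 0 < μ := by have := Real.pi_pos; positivity
  have hμ : Real.cos μ = 0 := Real.cos_eq_zero_iff.2 ⟨n, by simp only [μ]; push_cast; ring⟩
  set c : (ℝ → ℝ → ℝ) → ℝ → ℝ := fun v s => ∫ x in (0 : ℝ)..1, v s x * Real.cos (μ * x)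
  have hsub : ∫ x in (0 : ℝ)..1, (w' t x - w t x) * Real.cos (μ * x) = c w' t - c w t := by
    have hi : ∀ {v : ℝ → ℝ → ℝ}, IsClassicalSolution γ u v →
        IntervalIntegrable (fun x => v t x * Real.cos (μ * x)) volume 0 1 := fun hv => by
      refine ContinuousOn.intervalIntegrable ?_
      rw [uIcc_of_le zero_le_one]
      exact (hcont hv t ht).mul (by fun_prop)
    rw [← intervalIntegral.integral_sub (hi h') (hi h)]
    simp only [sub_mul]
  rw [hsub]
  -- The weighted difference of coefficients is the same at `T` as at `t`, and at `T` the growth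
  -- `exp (-γ T)` leaves the factor `exp (μ² T)`.
  have hdecay : ∀ T ≤ t, |Real.exp ((γ + μ ^ 2) * t) * (c w' t - c w t)| ≤
      (C + C') * Real.exp (μ ^ 2 * T) := by
    intro T hT
    have hT0 := hT.trans ht
    have e1 := (h'.coeff_sub hμ hT ht).trans (h.coeff_sub hμ hT ht).symm
    have e2 : Real.exp ((γ + μ ^ 2) * t) * (c w' t - c w t) =
        Real.exp ((γ + μ ^ 2) * T) * (c w' T - c w T) := by
      simp only [c]; linarith
    have b1 := abs_coeff_le (hcont h T hT0) (by positivity) (hw T hT0).le μ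
    have b2 := abs_coeff_le (hcont h' T hT0) (by positivity) (hw' T hT0).le μ
    have b3 : |c w' T - c w T| ≤ (C + C') * Real.exp (-γ * T) :=
      (abs_sub _ _).trans (by simp only [c]; linarith)
    rw [e2, abs_mul, abs_of_pos (Real.exp_pos _)]
    calc _ ≤ Real.exp ((γ + μ ^ 2) * T) * ((C + C') * Real.exp (-γ * T)) := by gcongr
      _ = (C + C') * (Real.exp ((γ + μ ^ 2) * T) * Real.exp (-γ * T)) := by ring
      _ = _ := by rw [← Real.exp_add]; congr 2; ring
  have hlim : Tendsto (fun T => (C + C') * Real.exp (μ ^ 2 * T)) atBot (𝓝 0) := by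
    have := (Real.tendsto_exp_atBot.comp
      (tendsto_id.const_mul_atBot (show 0 < μ ^ 2 by positivity))).const_mul (C + C')
    simpa using this
  have hle : |Real.exp ((γ + μ ^ 2) * t) * (c w' t - c w t)| ≤ 0 :=
    ge_of_tendsto hlim (eventually_atBot.2 ⟨t, fun T hT => hdecay T hT⟩)
  have := abs_nonpos_iff.1 hle
  exact (mul_eq_zero.1 this).resolve_left (Real.exp_pos _).ne'

end SteadyHeat

namespace SteadyHeat

open Filter Topology

/-! ### Regularity up to `x = 1` -/

theorem IsClassicalSolution.contDiffOn_of_memC1C2_one {γ : ℝ} {u : ℝ → ℝ} {w : ℝ → ℝ → ℝ}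
    (h : IsClassicalSolution γ u w) (hm : MemC1C2 w 1) : ContDiffOn ℝ 2 u (Iic 0) := by
  obtain ⟨W₀, W₂, hW₀, hW₂, h₀, -, hd⟩ := hm.exists_curves one_pos le_rfl h.heat
  have h2 : ContDiffOn ℝ (1 + 1) W₀ (Iic 0) := by
    refine (contDiffOn_succ_iff_derivWithin (uniqueDiffOn_Iic 0)).2
      ⟨hW₀.differentiableOn one_ne_zero, by simp, ?_⟩
    exact (hW₂.sub (hW₀.const_smul γ)).congr fun t ht =>
      (hd t ht).derivWithin (uniqueDiffOn_Iic 0 t ht)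
  have h3 := (ContinuousMap.evalCLM ℝ (⟨1, by simp⟩ : Icc (0 : ℝ) 1)).contDiff.comp_contDiffOn h2
  rw [one_add_one_eq_two] at h3
  refine h3.congr fun t ht => ?_
  rw [← h.dirichlet t ht]
  exact (h₀ t ht ⟨1, by simp⟩).symm

/-! ### From a `C²` density to regularity up to `x = 1`. -/

/-- Extend the derivative by induction and integrate; at order `0`, extend by a constant. -/
theorem exists_contDiff_extension (n : ℕ) {f : ℝ → ℝ} (hf : ContDiffOn ℝ n f (Iic 0)) :
    ∃ g : ℝ → ℝ, ContDiff ℝ n g ∧ EqOn g f (Iic 0) := by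
  induction n generalizing f with
  | zero =>
    refine ⟨fun t => f (min t 0), contDiff_zero.2 ?_, fun t ht => by simp only [min_eq_left (mem_Iic.1 ht)]⟩
    exact hf.continuousOn.comp_continuous (by fun_prop) fun t => mem_Iic.2 (min_le_right t 0)
  | succ n ih =>
    push_cast at hf ⊢
    obtain ⟨hd, -, hd'⟩ := (contDiffOn_succ_iff_derivWithin (uniqueDiffOn_Iic 0)).1 hf
    obtain ⟨e, he, hef⟩ := ih hd'
    have hg : ∀ t, HasDerivAt (fun t => f 0 + ∫ s in (0 : ℝ)..t, e s) (e t) t := fun t =>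
      (he.continuous.integral_hasStrictDerivAt 0 t).hasDerivAt.const_add _
    refine ⟨fun t => f 0 + ∫ s in (0 : ℝ)..t, e s, ?_, fun t ht => ?_⟩
    · refine contDiff_succ_iff_deriv.2 ⟨fun t => (hg t).differentiableAt,
        fun h => absurd h (WithTop.natCast_ne_top n), ?_⟩
      rw [funext fun t => (hg t).deriv]
      exact he
    · have := intervalIntegral.integral_eq_sub_of_hasDerivAt_of_le (f := f) (f' := e)
        (a := t) (b := 0) ht (hf.continuousOn.mono Icc_subset_Iic_self) (fun s hs => by
          have h1 := (hd s hs.2.le).hasDerivWithinAt.hasDerivAt (Iic_mem_nhds hs.2)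
          rwa [← hef (mem_Iic.2 hs.2.le)] at h1) (he.continuous.intervalIntegrable _ _)
      simp only
      rw [intervalIntegral.integral_symm, this]
      ring

theorem contDiff_restr_halfLine (n : ℕ) {φ : ℝ → ℝ} (hφ : ContDiff ℝ n φ)
    (hs : HasCompactSupport φ) :
    ContDiff ℝ n fun t => restr (Icc 0 1) fun x => halfLine φ t (1 - x) := by
  have hcont : ∀ {φ : ℝ → ℝ}, Continuous φ → HasCompactSupport φ →
      Continuous fun p : ℝ × ℝ => halfLine φ p.1 (1 - p.2) := fun hφ hs => by
    obtain ⟨B, hB⟩ := hs.exists_bound_of_continuous hφ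
    exact (continuous_halfLine hφ hB).comp (by fun_prop : Continuous fun p : ℝ × ℝ => (p.1, 1 - p.2))
  induction n generalizing φ with
  | zero =>
    refine contDiff_zero.2 (continuousOn_univ.1 (continuousOn_restr
      (F := fun t x => halfLine φ t (1 - x)) ?_))
    exact (hcont hφ.continuous hs).continuousOn
  | succ n ih =>
    push_cast at hφ ⊢
    obtain ⟨hd, -, hd'⟩ := contDiff_succ_iff_deriv.1 hφ
    obtain ⟨B, hB⟩ := hs.exists_bound_of_continuous hφ.continuous
    obtain ⟨B', hB'⟩ := hs.deriv.exists_bound_of_continuous hd'.continuous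
    have key : ∀ t, HasDerivAt (fun t => restr (Icc 0 1) fun x => halfLine φ t (1 - x))
        (restr (Icc 0 1) fun x => halfLine (deriv φ) t (1 - x)) t := fun t =>
      hasDerivAt_restr isOpen_univ (F := fun t x => halfLine φ t (1 - x))
        (F' := fun t x => halfLine (deriv φ) t (1 - x)) (hcont hφ.continuous hs).continuousOn
        (hcont hd'.continuous hs.deriv).continuousOn
        (fun t _ x _ => hasDerivAt_halfLine (fun s => (hd s).hasDerivAt) hd'.continuous.measurable
          hB hB' t (1 - x)) (mem_univ t)
    refine contDiff_succ_iff_deriv.2 ⟨fun t => (key t).differentiableAt,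
      fun h => absurd h (WithTop.natCast_ne_top n), ?_⟩
    rw [funext fun t => (key t).deriv]
    exact ih hd' hs.deriv

theorem admissible_of_eq_zero {φ : ℝ → ℝ} {c B : ℝ} (hφ : Measurable φ) (hB : ∀ s, |φ s| ≤ B)
    (hc : ∀ s, c < s → φ s = 0) : Admissible φ {p | c < p.1} := by
  refine ⟨hφ, ⟨B, hB⟩, isOpen_lt continuous_const continuous_fst, fun p hp => ?_⟩
  have hp' : c < p.1 := hp
  refine ⟨{q | (c + p.1) / 2 < q.1}, (isOpen_lt continuous_const continuous_fst).mem_nhds ?_,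
    (p.1 - c) / 2, by linarith, fun q hq s hs => Or.inr ?_⟩
  · change (c + p.1) / 2 < p.1
    linarith
  · have h1 : s ≤ c := not_lt.1 fun h => hs (hc s h)
    have h2 : (c + p.1) / 2 < q.1 := hq
    linarith

/-- Near `t₀`, split the density into a compactly supported `C²` part, whose time derivatives fall
on the density, and a part living before `t₀ - 1`, whose potential is smooth up to the boundary
because the time lag stays positive. The image at distance `1 + x` is always smooth. -/
theorem contDiffOn_restr_sol {φ : ℝ → ℝ} {B : ℝ} (hφ : Continuous φ) (hB : ∀ s, |φ s| ≤ B)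
    (hφ2 : ContDiffOn ℝ 2 φ (Iic 0)) :
    ContDiffOn ℝ 2 (fun t => restr (Icc 0 1) (sol φ t)) (Iic 0) := by
  intro t₀ ht₀
  obtain ⟨ψ, hψ, hψφ⟩ := exists_contDiff_extension 2 hφ2
  have ht₀' : t₀ ≤ 0 := ht₀
  set c := t₀ - 1
  -- The ball of centre `c / 2` and radius `-c / 2` is exactly `[c, 0]`.
  let χ : ContDiffBump (c / 2) := ⟨-c / 2, -c / 2 + 1, by simp only [c]; linarith, by linarith⟩
  have hχ : ∀ s, c ≤ s → s ≤ 0 → χ s = 1 := fun s h1 h2 => by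
    refine χ.one_of_mem_closedBall ?_
    rw [Metric.mem_closedBall, Real.dist_eq, abs_le]
    constructor <;> simp only [χ] <;> linarith
  set φ₁ : ℝ → ℝ := fun s => χ s * ψ s
  have hφ₁ : ContDiff ℝ 2 φ₁ := χ.contDiff.mul hψ
  have hs₁ : HasCompactSupport φ₁ := χ.hasCompactSupport.mul_right
  obtain ⟨B₁, hB₁⟩ := hs₁.exists_bound_of_continuous hφ₁.continuous
  simp only [Real.norm_eq_abs] at hB₁
  set φ₂ : ℝ → ℝ := (Iic c).indicator fun s => φ s - φ₁ s
  have hm₂ : Measurable φ₂ :=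
    (hφ.measurable.sub hφ₁.continuous.measurable).indicator measurableSet_Iic
  have hB₂ : ∀ s, |φ₂ s| ≤ B + B₁ := fun s => by
    by_cases h : s ∈ Iic c
    · simp only [φ₂, indicator_of_mem h]
      exact (abs_sub _ _).trans (add_le_add (hB s) (hB₁ s))
    · simp only [φ₂, indicator_of_notMem h, abs_zero]
      exact add_nonneg ((abs_nonneg _).trans (hB s)) ((abs_nonneg _).trans (hB₁ s))
  have hc₂ : ∀ s, c < s → φ₂ s = 0 := fun s hs => indicator_of_notMem (s := Iic c) (not_le.2 hs) _
  have hsplit : ∀ t ≤ 0, ∀ y, halfLine φ t y = halfLine φ₁ t y + halfLine φ₂ t y := by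
    intro t ht y
    rw [← halfLine_add hφ₁.continuous.measurable hm₂ hB₁ hB₂]
    refine halfLine_congr (fun s hs => ?_) y
    by_cases h : s ∈ Iic c
    · simp only [φ₂, indicator_of_mem h]; ring
    · rw [hc₂ s (not_le.1 h), add_zero]
      simp only [φ₁]
      rw [hχ s (not_le.1 h).le (hs.trans ht), one_mul, hψφ (hs.trans ht)]
  -- At `y = 0` both sides vanish, since `φ₂ t = 0` for `t > c`.
  have hpot : ∀ t, c < t → ∀ y, 0 ≤ y → halfLine φ₂ t y = y / kapMass * pot 3 φ₂ t y := by
    intro t ht y hy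
    rcases hy.eq_or_lt with rfl | hy
    · rw [halfLine_zero, hc₂ t ht, zero_div, zero_mul]
    · exact halfLine_eq_pot φ₂ t hy
  set Ω : Set (ℝ × ℝ) := {p | c < p.1} ∩ {p | 0 < 1 + p.2}
  have hΩ : IsOpen Ω := (isOpen_lt continuous_const continuous_fst).inter
    (isOpen_lt continuous_const (by fun_prop))
  set F : ℝ × ℝ → ℝ := fun p =>
    (1 - p.2) / kapMass * pot 3 φ₂ p.1 (1 - p.2) + halfLine φ p.1 (1 + p.2)
  have hF : ContDiffOn ℝ (⊤ : ℕ∞) F Ω := by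
    have h1 := ((admissible_of_eq_zero hm₂ hB₂ hc₂).contDiffOn_pot (m := 3) le_rfl).comp
      (f := fun p : ℝ × ℝ => (p.1, 1 - p.2)) (s := Ω) (by fun_prop) fun p hp => hp.1
    have h2 := (contDiffOn_halfLine hφ.measurable hB).comp
      (f := fun p : ℝ × ℝ => (p.1, 1 + p.2)) (s := Ω) (by fun_prop) fun p hp => hp.2
    have h3 : ContDiffOn ℝ (⊤ : ℕ∞) (fun p : ℝ × ℝ => (1 - p.2) / kapMass) Ω := by fun_prop
    exact (h3.mul h1).add h2
  have hIK : Ioi c ×ˢ Icc (0 : ℝ) 1 ⊆ Ω := fun p hp => ⟨hp.1, by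
    have := hp.2.1
    change 0 < 1 + p.2
    linarith⟩
  have h₂ := contDiffOn_restr isOpen_Ioi hΩ hIK 2 (contDiffOn_infty.1 hF 2)
  have h₁ := contDiff_restr_halfLine 2 hφ₁ hs₁
  have ht₀c : c < t₀ := by simp only [c]; linarith
  have hsum := (h₁.contDiffAt (x := t₀)).add (h₂.contDiffAt (Ioi_mem_nhds ht₀c))
  refine hsum.contDiffWithinAt.congr_of_eventuallyEq_of_mem ?_ ht₀
  filter_upwards [self_mem_nhdsWithin, mem_nhdsWithin_of_mem_nhds (Ioi_mem_nhds ht₀c)] with t ht htc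
  ext x
  have e0 : ContinuousOn (sol φ t) (Icc 0 1) :=
    ((continuous_sol hφ hB).comp (Continuous.prodMk_right t)).continuousOn
  have e1 : ContinuousOn (fun x => halfLine φ₁ t (1 - x)) (Icc 0 1) :=
    ((continuous_halfLine hφ₁.continuous hB₁).comp
      (by fun_prop : Continuous fun x : ℝ => (t, 1 - x))).continuousOn
  have e2 : ContinuousOn (fun x => F (t, x)) (Icc 0 1) :=
    hF.continuousOn.comp (f := fun x : ℝ => (t, x)) (by fun_prop) fun x hx => hIK ⟨htc, hx⟩
  rw [ContinuousMap.add_apply, restr_apply e0, restr_apply e1, restr_apply e2]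
  simp only [sol, F]
  rw [hsplit t ht (1 - x), hpot t htc _ (sub_nonneg.2 x.2.2), add_assoc]

/-- The time derivative `D` of the `C²` curve is a `C¹` curve in `C([0, 1])` and equals the second
space derivative for `x < 1`. Integrating `D` twice in `x` therefore gives back the solution, and
its space derivatives on all of `[0, 1]` are curves built from `D` by bounded operators. -/
theorem memC1C2_one_dampedSol (γ : ℝ) {φ : ℝ → ℝ} {B : ℝ} (hφ : Continuous φ)
    (hB : ∀ s, |φ s| ≤ B) (hφ2 : ContDiffOn ℝ 2 φ (Iic 0)) : MemC1C2 (dampedSol γ φ) 1 := by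
  have h01 : (0 : ℝ) ≤ 1 := zero_le_one
  have hu := uniqueDiffOn_Icc (zero_lt_one' ℝ)
  have hV := contDiffOn_restr_sol hφ hB hφ2
  set V : ℝ → C(Icc (0 : ℝ) 1, ℝ) := fun t => restr (Icc 0 1) (sol φ t)
  obtain ⟨hVd, -, hD⟩ := (contDiffOn_succ_iff_derivWithin (n := 1) (uniqueDiffOn_Iic 0)).1 hV
  set D : ℝ → C(Icc (0 : ℝ) 1, ℝ) := derivWithin V (Iic 0)
  have hS : ∀ t, Continuous (sol φ t) := fun t =>
    (continuous_sol hφ hB).comp (Continuous.prodMk_right t)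
  have hVS : ∀ t (x : Icc (0 : ℝ) 1), V t x = sol φ t x := fun t x =>
    restr_apply (hS t).continuousOn x
  have hDT : ∀ t ≤ 0, ∀ x : Icc (0 : ℝ) 1, (x : ℝ) < 1 →
      D t x = halfLineT φ t (1 - x) + halfLineT φ t (1 + x) := by
    intro t ht x hx
    have h1 := (ContinuousMap.evalCLM ℝ x).hasFDerivAt.comp_hasDerivWithinAt t
      (hVd t ht).hasDerivWithinAt
    have h2 : HasDerivWithinAt (fun s => sol φ s x) (D t x) (Iic 0) t :=
      h1.congr (fun s _ => (hVS s x).symm) (hVS t x).symm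
    have h3 := (hasDerivAt_sol_fst hφ.measurable hB t (x := x)
      ⟨by linarith [x.2.1], hx⟩).hasDerivWithinAt (s := Iic 0)
    exact (uniqueDiffOn_Iic 0 t ht).eq_deriv _ h2 h3
  set d : ℝ → ℝ → ℝ := fun t => IccExtend h01 (D t)
  have hd : ∀ t, Continuous (d t) := fun t => (D t).continuous.Icc_extend'
  set P : ℝ → ℝ → ℝ := fun t x => ∫ z in (0 : ℝ)..x, d t z
  have hP : ∀ t x, HasDerivAt (P t) (d t x) x := fun t x =>
    ((hd t).integral_hasStrictDerivAt 0 x).hasDerivAt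
  have hPc : ∀ t, Continuous (P t) := fun t =>
    continuous_iff_continuousAt.2 fun x => (hP t x).continuousAt
  set Q : ℝ → ℝ → ℝ := fun t x => sol φ t 0 + ∫ z in (0 : ℝ)..x, P t z
  have hQ : ∀ t x, HasDerivAt (Q t) (P t x) x := fun t x =>
    ((hPc t).integral_hasStrictDerivAt 0 x).hasDerivAt.const_add _
  have hSQ : ∀ t ≤ 0, EqOn (sol φ t) (Q t) (Icc 0 1) := by
    intro t ht
    have hm : ∀ {x y : ℝ}, x ∈ Ico (0 : ℝ) 1 → y ∈ uIcc 0 x → y ∈ Ico (0 : ℝ) 1 := fun hx hy => by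
      rw [uIcc_of_le hx.1] at hy
      exact ⟨hy.1, hy.2.trans_lt hx.2⟩
    have hm' : ∀ {y : ℝ}, y ∈ Ico (0 : ℝ) 1 → y ∈ Ioo (-1 : ℝ) 1 := fun hy =>
      ⟨by linarith [hy.1], hy.2⟩
    set G : ℝ → ℝ := fun x => -halfLineX φ t (1 - x) + halfLineX φ t (1 + x)
    have hG : ∀ x ∈ Ico (0 : ℝ) 1, G x = P t x := fun x hx => by
      have := intervalIntegral.integral_eq_sub_of_hasDerivAt (f := G) (f' := d t) (a := 0) (b := x)
        (fun y hy => by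
          have h1 := hasDerivAt_sol_snd_snd hφ.measurable hB t (hm' (hm hx hy))
          refine h1.congr_deriv ?_
          simp only [d]
          rw [IccExtend_of_mem h01 _ ⟨(hm hx hy).1, (hm hx hy).2.le⟩, hDT t ht _ (hm hx hy).2])
        ((hd t).intervalIntegrable _ _)
      simp only [P, this, G]
      simp
    have h1 : EqOn (sol φ t) (Q t) (Ico 0 1) := fun x hx => by
      have := intervalIntegral.integral_eq_sub_of_hasDerivAt (f := sol φ t) (f' := P t)
        (a := 0) (b := x) (fun y hy => by
          rw [← hG y (hm hx hy)]
          exact hasDerivAt_sol_snd hφ.measurable hB t (hm' (hm hx hy)))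
        ((hPc t).intervalIntegrable _ _)
      simp only [Q, this]
      ring
    have h2 := h1.closure (hS t)
      (continuous_iff_continuousAt.2 fun x => (hQ t x).continuousAt)
    rwa [closure_Ico zero_ne_one] at h2
  have hwQ : ∀ t ≤ 0, EqOn (dampedSol γ φ t) (fun x => Real.exp (-γ * t) * Q t x) (Icc 0 1) :=
    fun t ht x hx => by simp only [dampedSol, hSQ t ht hx]
  have hQ2 : ∀ t, ContDiff ℝ 2 (Q t) := fun t => by
    have h1 : ContDiff ℝ (0 + 1) (P t) := contDiff_succ_iff_deriv.2
      ⟨fun x => (hP t x).differentiableAt, by simp, by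
        rw [funext fun x => (hP t x).deriv]; exact contDiff_zero.2 (hd t)⟩
    rw [zero_add] at h1
    exact (contDiff_succ_iff_deriv (n := 1)).2 ⟨fun x => (hQ t x).differentiableAt, by simp, by
      rw [funext fun x => (hQ t x).deriv]; exact h1⟩
  have hexp : ContDiffOn ℝ 1 (fun t => Real.exp (-γ * t)) (Iic 0) := by fun_prop
  have i1 : ∀ t ≤ 0, ∀ x ∈ Icc (0 : ℝ) 1,
      iteratedDerivWithin 1 (dampedSol γ φ t) (Icc 0 1) x = Real.exp (-γ * t) * P t x := by
    intro t ht x hx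
    rw [iteratedDerivWithin_one, derivWithin_congr (hwQ t ht) (hwQ t ht hx)]
    exact ((hQ t x).const_mul _).hasDerivWithinAt.derivWithin (hu x hx)
  refine ⟨fun t ht => (contDiffOn_const.mul (hQ2 t).contDiffOn).congr (hwQ t ht), fun j hj => ?_⟩
  interval_cases j
  · refine ⟨fun t => Real.exp (-γ * t) • V t, hexp.smul (hV.of_le one_le_two), fun t _ x => ?_⟩
    rw [iteratedDerivWithin_zero, ContinuousMap.smul_apply, hVS, smul_eq_mul, dampedSol]
  · refine ⟨fun t => Real.exp (-γ * t) • primitive h01 (D t),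
      hexp.smul ((primitive h01).contDiff.comp_contDiffOn hD), fun t ht x => ?_⟩
    rw [i1 t ht x x.2, ContinuousMap.smul_apply, primitive_apply, smul_eq_mul]
  · refine ⟨fun t => Real.exp (-γ * t) • D t, hexp.smul hD, fun t ht x => ?_⟩
    rw [iteratedDerivWithin_succ, derivWithin_congr (i1 t ht) (i1 t ht x x.2),
      ((hP t x).const_mul _).hasDerivWithinAt.derivWithin (hu x x.2), ContinuousMap.smul_apply,
      smul_eq_mul]
    simp only [d, IccExtend_val]

/-- The values at distance `2` from the boundary are smooth in time whatever `φ` is, so `φ` inherits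
the regularity of `u`. -/
theorem contDiffOn_density {φ u : ℝ → ℝ} {γ B : ℝ} (hφ : Measurable φ) (hB : ∀ s, |φ s| ≤ B)
    (h : ∀ t ≤ 0, φ t + halfLine φ t 2 = Real.exp (γ * t) * u t) (hu : ContDiffOn ℝ 2 u (Iic 0)) :
    ContDiffOn ℝ 2 φ (Iic 0) := by
  have h1 := (contDiffOn_infty.1 (contDiffOn_halfLine hφ hB) 2).comp
    (f := fun t : ℝ => (t, (2 : ℝ))) (s := Iic 0) (by fun_prop) fun t _ => two_pos (α := ℝ)
  have h2 : ContDiffOn ℝ 2 (fun t => Real.exp (γ * t)) (Iic 0) := by fun_prop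
  exact ((h2.mul hu).sub h1).congr fun t ht => eq_sub_of_add_eq (h t ht)

end SteadyHeat

/-! ### The main theorem. -/

theorem mainTheorem4 (γ : ℝ) (hγ : 0 < γ) (u : ℝ → ℝ) (hu : ContinuousOn u (Set.Iic 0))
    (hbdd : ∃ M : ℝ, ∀ t ≤ 0, |Real.exp (γ * t) * u t| ≤ M) :
    ∃ w : ℝ → ℝ → ℝ,
      SteadyHeat.IsClassicalSolution γ u w ∧
      SteadyHeat.HasL2Bound γ w ∧
      (∀ w' : ℝ → ℝ → ℝ, SteadyHeat.IsClassicalSolution γ u w' → SteadyHeat.HasL2Bound γ w' →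
        ∀ t ≤ 0, ∀ x ∈ Set.Icc (0 : ℝ) 1, w' t x = w t x) ∧
      (∀ t ≤ 0, w t ∈ SteadyHeat.spaceA) ∧
      (SteadyHeat.MemC1C2 w 1 ↔ ContDiffOn ℝ 2 u (Set.Iic 0)) := by
  obtain ⟨M, hM⟩ := hbdd
  -- The boundary data are frozen at their value at `t = 0` for positive times, so that the density
  -- equation can be solved on the whole line.
  have hg : Continuous fun t => Real.exp (γ * min t 0) * u (min t 0) := by
    have h1 : Continuous fun t => u (min t 0) :=
      hu.comp_continuous (by fun_prop) fun t => mem_Iic.2 (min_le_right t 0)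
    exact (by fun_prop : Continuous fun t => Real.exp (γ * min t 0)).mul h1
  obtain ⟨φ, hφ, ⟨B, hB⟩, h⟩ := SteadyHeat.exists_density hg fun t => hM _ (min_le_right t 0)
  have h' : ∀ t ≤ 0, φ t + SteadyHeat.halfLine φ t 2 = Real.exp (γ * t) * u t := fun t ht => by
    have := h t
    rwa [min_eq_left ht] at this
  have hsol := SteadyHeat.isClassicalSolution_dampedSol hφ hB h'
  have hL2 := SteadyHeat.hasL2Bound_dampedSol γ hB
  exact ⟨SteadyHeat.dampedSol γ φ, hsol, hL2,
    fun w' hw' hb' => hsol.eq_of_hasL2Bound hL2 hw' hb',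
    fun t _ => SteadyHeat.dampedSol_mem_spaceA γ hφ hB t,
    hsol.contDiffOn_of_memC1C2_one, fun hu2 => SteadyHeat.memC1C2_one_dampedSol γ hφ hB
      (SteadyHeat.contDiffOn_density hφ.measurable hB h' hu2)⟩
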